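/- All spaces are Hausdorff. For a compact space $X$, let $C(X)=C(X,\mathbb C)$ be the algebra of continuous complex-valued functions on $X$ with the supremum norm $\|\cdot\|$, and write $\mathcal A \leqslant_c C(X)$ if $\mathcal A$ is a closed subalgebra of $C(X)$ that separates points and contains the constant functions. For a closed $F\subseteq X$ put $\|f\|_F=\sup\{|f(x)|:x\in F\}$; $F$ is a boundary for $\mathcal A$ if $\|f\|_F=\|f\|$ for all $f\in\mathcal A$, and the Shilov boundary $\operatorname{Sh}(\mathcal A)$ is the smallest closed boundary for $\mathcal A$. An idempotent of $\mathcal A$ (an $f\in\mathcal A$ with $f^2=f$) is trivial if it is the constant function $0$ or $1$. A compact space $H$ is called removable if, for every compact space $X$, every open $U\subsetneq X$ such that $\overline U$ is homeomorphic to a subspace of $H$, and every $\mathcal A\leqslant_c C(X)$ all of whose idempotents are trivial, one has $\operatorname{Sh}(\mathcal A)\subseteq X\setminus U$. A LOTS is a linearly ordered set with its order topology. **Lemma.** Every compact separable LOTS that does not contain a subspace homeomorphic to the Cantor set is removable. -/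

import Mathlib

section ComplexFunctionAlgebras

variable {X : Type*} [TopologicalSpace X] [CompactSpace X]

/-- `A` is a closed subalgebra of `C(X, ℂ)` that contains the constants (every `Subalgebra ℂ` does)
and separates points. -/
structure IsClosedSeparating (A : Subalgebra ℂ C(X, ℂ)) : Prop where
  separatesPoints : A.SeparatesPoints
  isClosed : IsClosed (A : Set C(X, ℂ))

/-- The only idempotents of `A` are the constant functions `0` and `1`. -/
def OnlyTrivialIdempotents (A : Subalgebra ℂ C(X, ℂ)) : Prop :=
  ∀ f ∈ A, f * f = f → f = 0 ∨ f = 1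

/-- `‖f‖_H = sup {|f x| : x ∈ H}` (which is `0` when `H` is empty). -/
noncomputable def supNormOn (f : C(X, ℂ)) (H : Set X) : ℝ :=
  sSup ((fun x => ‖f x‖) '' H)

/-- `H` is a (closed) boundary for `A`: it is closed and `‖f‖_H = ‖f‖` for all `f ∈ A`. -/
def IsBoundaryFor (A : Subalgebra ℂ C(X, ℂ)) (H : Set X) : Prop :=
  IsClosed H ∧ ∀ f ∈ A, supNormOn f H = ‖f‖

/-- The Shilov boundary of `A`: the smallest closed boundary, obtained as the intersection of all
closed boundaries. That it is the smallest one is `isLeast_shilovBoundary` below. -/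
def shilovBoundary (A : Subalgebra ℂ C(X, ℂ)) : Set X :=
  ⋂₀ {H | IsBoundaryFor A H}

theorem isBoundaryFor_iff (A : Subalgebra ℂ C(X, ℂ)) [Nonempty X] (H : Set X) :
    IsBoundaryFor A H ↔ IsClosed H ∧ ∀ f ∈ A, (∀ x ∈ H, ‖f x‖ < 1) → ‖f‖ < 1 := by
  refine and_congr_right fun hH => ⟨fun h f hf hlt => ?_, fun h => ?_⟩
  · rw [← h f hf]
    rcases H.eq_empty_or_nonempty with rfl | hne
    · simp [supNormOn]
    · obtain ⟨x, hx, hxe⟩ := hH.isCompact.exists_sSup_image_eq hne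
        (f := fun x => ‖f x‖) (by fun_prop)
      rw [supNormOn, hxe]
      exact hlt x hx
  · have hne : H.Nonempty := by
      by_contra hemp
      rw [Set.not_nonempty_iff_eq_empty] at hemp
      subst hemp
      have := h 1 A.one_mem (by simp)
      simp at this
    intro f hf
    have hle : supNormOn f H ≤ ‖f‖ := by
      refine csSup_le (hne.image _) ?_
      rintro _ ⟨x, -, rfl⟩
      exact f.norm_coe_le_norm x
    refine le_antisymm hle ?_
    by_contra! hlt
    have hpos : 0 ≤ supNormOn f H := by
      refine Real.sSup_nonneg ?_
      rintro _ ⟨x, -, rfl⟩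
      positivity
    have hf0 : 0 < ‖f‖ := lt_of_le_of_lt hpos hlt
    have hbdd : BddAbove ((fun x => ‖f x‖) '' H) := by
      refine ⟨‖f‖, ?_⟩
      rintro _ ⟨x, -, rfl⟩
      exact f.norm_coe_le_norm x
    have := h (((‖f‖⁻¹ : ℝ) : ℂ) • f) (A.smul_mem hf _) (fun x hx => by
      have h1 : ‖f x‖ ≤ supNormOn f H := le_csSup hbdd ⟨x, hx, rfl⟩
      have h2 : ‖f x‖ < ‖f‖ := lt_of_le_of_lt h1 hlt
      simp only [ContinuousMap.smul_apply, norm_smul, Complex.norm_real, norm_inv, norm_norm]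
      rw [inv_mul_lt_iff₀ hf0]
      simpa using h2)
    rw [norm_smul, Complex.norm_real, norm_inv, norm_norm, inv_mul_cancel₀ hf0.ne'] at this
    exact lt_irrefl _ this

theorem IsBoundaryFor.diff {A : Subalgebra ℂ C(X, ℂ)} [Nonempty X] {E F : Set X}
    (hE : IsBoundaryFor A E) (hF : IsBoundaryFor A F) (s : Finset C(X, ℂ)) (hs : ∀ h ∈ s, h ∈ A)
    (hdisj : ∀ x ∈ E, ∃ h ∈ s, 1 ≤ ‖h x‖) :
    IsBoundaryFor A (F \ {x | ∀ h ∈ s, ‖h x‖ < 1}) := by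
  rw [isBoundaryFor_iff] at hE hF ⊢
  have hop : IsOpen {x : X | ∀ h ∈ s, ‖h x‖ < 1} := by
    have : {x : X | ∀ h ∈ s, ‖h x‖ < 1} = ⋂ h ∈ s, {x | ‖h x‖ < 1} := by ext; simp
    rw [this]
    exact isOpen_biInter_finset fun h _ => isOpen_lt (by fun_prop) continuous_const
  have hcl := hF.1.sdiff hop
  refine ⟨hcl, fun f hf hlt => ?_⟩
  by_contra! hge
  have hf0 : 0 < ‖f‖ := by linarith
  -- normalise `f` to norm one
  obtain ⟨g, hg⟩ : ∃ g : C(X, ℂ), g = ((‖f‖⁻¹ : ℝ) : ℂ) • f := ⟨_, rfl⟩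
  have hgA : g ∈ A := hg ▸ A.smul_mem hf _
  have hg1 : ‖g‖ = 1 := by
    rw [hg, norm_smul, Complex.norm_real, norm_inv, norm_norm, inv_mul_cancel₀ hf0.ne']
  have hgx : ∀ x, ‖g x‖ ≤ 1 := fun x => hg1 ▸ g.norm_coe_le_norm x
  have hglt : ∀ x ∈ F \ {x | ∀ h ∈ s, ‖h x‖ < 1}, ‖g x‖ < 1 := fun x hx => by
    have h1 := hlt x hx
    simp only [hg, ContinuousMap.smul_apply, norm_smul, Complex.norm_real, norm_inv, norm_norm]
    rw [inv_mul_lt_iff₀ hf0]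
    simpa using h1.trans_le hge
  obtain ⟨r, hr0, hr1, hr⟩ : ∃ r : ℝ, 0 ≤ r ∧ r < 1 ∧
      ∀ x ∈ F \ {x | ∀ h ∈ s, ‖h x‖ < 1}, ‖g x‖ ≤ r := by
    rcases (F \ {x | ∀ h ∈ s, ‖h x‖ < 1}).eq_empty_or_nonempty with he | hne
    · exact ⟨0, le_rfl, one_pos, by simp [he]⟩
    · obtain ⟨x, hx, hmax⟩ := hcl.isCompact.exists_isMaxOn hne
        (f := fun x => ‖g x‖) (by fun_prop)
      exact ⟨‖g x‖, norm_nonneg _, hglt x hx, fun y hy => hmax hy⟩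
  -- a bound for all the functions in `s`
  obtain ⟨M, hMpos, hMle⟩ : ∃ M : ℝ, 0 < M ∧ ∀ h ∈ s, ‖h‖ ≤ M := by
    refine ⟨∑ h ∈ s, ‖h‖ + 1, add_pos_of_nonneg_of_pos
      (Finset.sum_nonneg fun h _ => norm_nonneg h) one_pos, fun h hh => ?_⟩
    have := Finset.single_le_sum (f := fun h : C(X, ℂ) => ‖h‖) (fun i _ => norm_nonneg i) hh
    exact this.trans (le_add_of_nonneg_right zero_le_one)
  obtain ⟨n, hn⟩ := exists_pow_lt_of_lt_one (inv_pos.2 hMpos) hr1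
  have key : ∀ h ∈ s, ‖g ^ n * h‖ < 1 := fun h hh => by
    refine hF.2 _ (A.mul_mem (A.pow_mem hgA n) (hs h hh)) fun x hx => ?_
    simp only [ContinuousMap.mul_apply, ContinuousMap.pow_apply, norm_mul, norm_pow]
    by_cases hxV : ∀ h ∈ s, ‖h x‖ < 1
    · calc ‖g x‖ ^ n * ‖h x‖ ≤ 1 * ‖h x‖ := by
            gcongr
            exact pow_le_one₀ (norm_nonneg _) (hgx x)
        _ < 1 := by simpa using hxV h hh
    · calc ‖g x‖ ^ n * ‖h x‖ ≤ r ^ n * M := by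
            gcongr
            · exact hr x ⟨hx, hxV⟩
            · exact (h.norm_coe_le_norm x).trans (hMle h hh)
        _ < M⁻¹ * M := by gcongr
        _ = 1 := inv_mul_cancel₀ hMpos.ne'
  refine absurd (hE.2 g hgA fun x hx => ?_) (by simp [hg1])
  obtain ⟨h, hh, hhx⟩ := hdisj x hx
  by_contra! hc
  have h1 : ‖g x‖ = 1 := le_antisymm (hgx x) hc
  have h2 := ((g ^ n * h).norm_coe_le_norm x).trans_lt (key h hh)
  simp only [ContinuousMap.mul_apply, ContinuousMap.pow_apply, norm_mul, norm_pow, h1, one_pow,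
    one_mul] at h2
  linarith

/-- A point outside a closed set `E` is separated from it by finitely many functions in `A`. -/
theorem exists_finset_separating [T2Space X] {A : Subalgebra ℂ C(X, ℂ)} (hA : A.SeparatesPoints)
    {E : Set X} (hE : IsClosed E) {x : X} (hx : x ∉ E) :
    ∃ s : Finset C(X, ℂ), (∀ h ∈ s, h ∈ A) ∧ (∀ h ∈ s, ‖h x‖ < 1) ∧
      ∀ y ∈ E, ∃ h ∈ s, 1 ≤ ‖h y‖ := by
  classical
  have hsep : ∀ y ∈ E, ∃ h ∈ A, h x = 0 ∧ 1 < ‖h y‖ := fun y hy => by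
    have hxy : x ≠ y := fun h => hx (h ▸ hy)
    obtain ⟨_, ⟨f, hf, rfl⟩, hne⟩ := hA hxy
    have hd : f y - f x ≠ 0 := sub_ne_zero.2 (Ne.symm hne)
    refine ⟨(2 * (f y - f x)⁻¹) • (f - algebraMap ℂ C(X, ℂ) (f x)),
      A.smul_mem (A.sub_mem hf (A.algebraMap_mem _)) _, ?_, ?_⟩
    · simp
    · simp [hd]
  choose! g hgA hgx hgy using hsep
  obtain ⟨t, htE, ht⟩ := hE.isCompact.elim_nhds_subcover (fun y => {z | 1 < ‖g y z‖})
    fun y hy => (isOpen_lt continuous_const (by fun_prop)).mem_nhds (hgy y hy)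
  refine ⟨t.image g, ?_, ?_, fun y hy => ?_⟩
  · simpa using fun y hy => hgA y (htE y hy)
  · simpa using fun y hy => by simp [hgx y (htE y hy)]
  · obtain ⟨z, hz, hyz⟩ := Set.mem_iUnion₂.1 (ht hy)
    exact ⟨g z, Finset.mem_image_of_mem _ hz, le_of_lt hyz⟩

/-- The Shilov boundary is the smallest closed boundary. -/
theorem isLeast_shilovBoundary [T2Space X] {A : Subalgebra ℂ C(X, ℂ)} (hA : A.SeparatesPoints) :
    IsLeast {H | IsBoundaryFor A H} (shilovBoundary A) := by
  classical
  refine ⟨?_, fun H hH => Set.sInter_subset_of_mem hH⟩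
  have hSc : IsClosed (shilovBoundary A) := isClosed_sInter fun H hH => hH.1
  rcases isEmpty_or_nonempty X with hX | hX
  · refine ⟨hSc, fun f _ => ?_⟩
    have h1 : shilovBoundary A = ∅ := Set.eq_empty_of_isEmpty _
    have h2 : f = 0 := ContinuousMap.ext fun x => isEmptyElim x
    simp [h1, h2, supNormOn]
  refine (isBoundaryFor_iff A _).2 ⟨hSc, fun f hf hlt => ?_⟩
  have huniv : IsBoundaryFor A Set.univ := (isBoundaryFor_iff A _).2
    ⟨isClosed_univ, fun f _ h => (ContinuousMap.norm_lt_iff f one_pos).2 fun x => h x trivial⟩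
  have hK : IsCompact {x | 1 ≤ ‖f x‖} :=
    (isClosed_le continuous_const (by fun_prop)).isCompact
  have hloc : ∀ x ∈ {x | 1 ≤ ‖f x‖}, ∃ s : Finset C(X, ℂ), (∀ h ∈ s, ‖h x‖ < 1) ∧
      ∀ F, IsBoundaryFor A F → IsBoundaryFor A (F \ {y | ∀ h ∈ s, ‖h y‖ < 1}) := fun x hx => by
    have hxS : x ∉ shilovBoundary A := fun h => absurd (hlt x h) (not_lt.2 hx)
    obtain ⟨E, hE, hxE⟩ : ∃ E, IsBoundaryFor A E ∧ x ∉ E := by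
      simpa [shilovBoundary] using hxS
    obtain ⟨s, hsA, hsx, hsE⟩ := exists_finset_separating hA hE.1 hxE
    exact ⟨s, hsx, fun F hF => hE.diff hF s hsA hsE⟩
  choose! s hsx hs using hloc
  obtain ⟨t, htK, ht⟩ := hK.elim_nhds_subcover (fun x => {y | ∀ h ∈ s x, ‖h y‖ < 1})
    fun x hx => by
      have : {y : X | ∀ h ∈ s x, ‖h y‖ < 1} = ⋂ h ∈ s x, {y | ‖h y‖ < 1} := by ext; simp
      refine IsOpen.mem_nhds ?_ (hsx x hx)
      rw [this]
      exact isOpen_biInter_finset fun h _ => isOpen_lt (by fun_prop) continuous_const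
  have hind : ∀ t' : Finset X, t' ⊆ t →
      IsBoundaryFor A (Set.univ \ ⋃ x ∈ t', {y | ∀ h ∈ s x, ‖h y‖ < 1}) := by
    intro t'
    induction t' using Finset.induction_on with
    | empty => intro _; simpa using huniv
    | insert a t' _ ih =>
      intro hsub
      have h1 := hs a (htK a (hsub (Finset.mem_insert_self _ _))) _
        (ih fun y hy => hsub (Finset.mem_insert_of_mem hy))
      rw [Set.sdiff_sdiff, Set.union_comm] at h1
      rwa [Finset.set_biUnion_insert]
  refine ((isBoundaryFor_iff A _).1 (hind t subset_rfl)).2 f hf fun x hx => ?_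
  by_contra! hc
  exact hx.2 (ht hc)

end ComplexFunctionAlgebras

/-- `X` contains a Cantor subset: a subspace homeomorphic to the Cantor space `2^ℕ`. -/
def ContainsCantorSubset (X : Type*) [TopologicalSpace X] : Prop :=
  ∃ C : Set X, Nonempty (C ≃ₜ (ℕ → Bool))

universe u v

/-- A compact Hausdorff space `H` is removable: for every compact Hausdorff `X`, every proper open
`U ⊂ X` whose closure is homeomorphic to a subspace of `H`, and every closed point-separating
subalgebra `A` of `C(X, ℂ)` with constants and with only trivial idempotents, the Shilov boundary
of `A` misses `U`. The spaces `X` range over an arbitrary universe `v`. -/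
def IsRemovable (H : Type u) [TopologicalSpace H] [CompactSpace H] [T2Space H] : Prop :=
  ∀ (X : Type v) [TopologicalSpace X] [CompactSpace X] [T2Space X]
    (U : Set X) (A : Subalgebra ℂ C(X, ℂ)),
    IsOpen U → U ≠ Set.univ →
    (∃ Z : Set H, Nonempty (closure U ≃ₜ Z)) →
    IsClosedSeparating A → OnlyTrivialIdempotents A →
    shilovBoundary A ⊆ Uᶜ

/-! Suppose the Shilov boundary meets `U`. Then some `f ∈ A` has `‖f‖` strictly above `ρ`, the
maximum of `|f|` on `X \ U`. Everything happens where `|f| > ρ`, hence inside `U`, which `ψ` embeds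
in the ordered space `L`.

Take a closed separable subalgebra `B ⊆ A` containing `f`, and let `Ω` be the unbounded component of
the resolvent set of `f` in `B`. Its frontier consists of values of `f`. The part of the frontier
beyond radius `ρ` is uncountable: otherwise some circle and some ray miss it, and then a circle in
`Ω` separates values of `f` and yields a nontrivial idempotent
(`OnlyTrivialIdempotents.not_countable_frontier`).

Over each frontier point `z`, the square root of `(f - p) / (f - q)` with `p, q ∈ Ω` near `z` gives
peaking functions with a uniform bound (`exists_peaking`). So `f ⁻¹' {z}` is a weak peak set, and a
minimal weak peak set inside it is a fibre of the joint evaluation of the generators of `B`. This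
gives an uncountable Borel set of peaking fibres inside `U`.

If all but countably many of them were singletons, `L` would contain a Cantor set. So uncountably
many have at least two points. The generators of `B` separate the two sides of every jump between
points of a countable dense set `D` or their immediate neighbours, so such a fibre is a pair `a, b`
spanning a gap of `L` that avoids `D`. A function `h ∈ A` with `h a = 0`, `h b = 1`, times a
function `F ∈ B` peaking on the pair, is a step at the gap cut off outside a short interval. By
pigeonhole two pairs share the interval endpoints in `D` and have nearly equal `F`; the difference
of the two products is nearly the indicator of the part of `U` between the gaps, a contradiction
(`IsCut.false_of_lt`). -/

open Set Filter Topology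

/-! ### Holomorphic calculus and approximate idempotents -/

section ClosedSubalgebra

variable {X : Type*} [TopologicalSpace X] [CompactSpace X] {A : Subalgebra ℂ C(X, ℂ)}

/-- A closed subalgebra of `C(X, ℂ)` is stable under holomorphic functions on the unit disc. -/
theorem exists_mem_eq_comp (hA : IsClosed (A : Set C(X, ℂ))) {φ : ℂ → ℂ}
    (hφ : DifferentiableOn ℂ φ (Metric.ball 0 1)) {w : C(X, ℂ)} (hw : w ∈ A) (hw1 : ‖w‖ < 1) :
    ∃ g ∈ A, ∀ x, g x = φ (w x) := by
  obtain ⟨r, hr, hr1⟩ := exists_between hw1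
  obtain ⟨R, hR, hR1⟩ := exists_between hr1
  lift r to NNReal using (norm_nonneg w).trans hr.le
  lift R to NNReal using r.2.trans hR.le
  have hball := (hφ.mono (Metric.closedBall_subset_ball hR1)).hasFPowerSeriesOnBall
    (lt_of_le_of_lt r.2 hR)
  -- With `‖w‖ < r < R < 1` the Taylor polynomials converge uniformly on a disc containing all
  -- values of `w`, so polynomials in `w` approximate `φ ∘ w` in norm.
  have hun := hball.tendstoUniformlyOn (r' := r) (by exact_mod_cast hR)
  set p := cauchyPowerSeries φ 0 R
  have hwx : ∀ x, w x ∈ Metric.ball (0 : ℂ) r := fun x => by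
    simpa using (w.norm_coe_le_norm x).trans_lt hr
  have hcont : Continuous fun x => φ (w x) := by
    refine hφ.continuousOn.comp_continuous w.continuous fun x => ?_
    exact Metric.ball_subset_ball hr1.le (hwx x)
  refine ⟨⟨fun x => φ (w x), hcont⟩, ?_, fun x => rfl⟩
  refine hA.closure_subset_iff.2 (subset_refl _) ?_
  refine Metric.mem_closure_iff.2 fun ε hε => ?_
  obtain ⟨n, hn⟩ := (Metric.tendstoUniformlyOn_iff.1 hun (ε / 2) (half_pos hε)).exists
  refine ⟨∑ k ∈ Finset.range n, p.coeff k • w ^ k,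
    A.sum_mem fun k _ => A.smul_mem (A.pow_mem hw k) _, ?_⟩
  refine lt_of_le_of_lt ((ContinuousMap.dist_le (half_pos hε).le).2 fun x => ?_) (half_lt_self hε)
  have := (hn (w x) (hwx x)).le
  simpa [FormalMultilinearSeries.partialSum, mul_comm] using this

/-- An element of a closed subalgebra without nontrivial idempotents which is everywhere close to
`0` or to `1` is everywhere close to `0` or everywhere close to `1`. -/
theorem OnlyTrivialIdempotents.forall_or_forall (hA : IsClosed (A : Set C(X, ℂ)))
    (hid : OnlyTrivialIdempotents A) {G : C(X, ℂ)} (hG : G ∈ A)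
    (h : ∀ x, ‖G x‖ ≤ 1 / 4 ∨ ‖G x - 1‖ ≤ 1 / 4) :
    (∀ x, ‖G x‖ ≤ 1 / 4) ∨ ∀ x, ‖G x - 1‖ ≤ 1 / 4 := by
  classical
  have hdisj : ∀ x, ‖G x‖ ≤ 1 / 4 → ¬ ‖G x - 1‖ ≤ 1 / 4 := fun x h0 h1 => by
    have := norm_sub_norm_le (1 : ℂ) (G x)
    rw [norm_sub_rev, norm_one] at this
    linarith
  obtain ⟨s, hs⟩ : ∃ s : Set X, s = {x | ‖G x - 1‖ ≤ 1 / 4} := ⟨_, rfl⟩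
  have hsc : sᶜ = {x | ‖G x‖ ≤ 1 / 4} := by
    ext x
    simp only [hs, mem_compl_iff, mem_ofPred_eq]
    exact ⟨fun hx => (h x).resolve_right hx, hdisj x⟩
  have hclopen : IsClopen s := by
    refine ⟨hs ▸ isClosed_le (by fun_prop) continuous_const, ?_⟩
    rw [← isClosed_compl_iff, hsc]
    exact isClosed_le (by fun_prop) continuous_const
  let χ : C(X, ℂ) := ⟨s.indicator 1, hclopen.continuous_indicator continuous_one⟩
  have hχ1 : ∀ x ∈ s, χ x = 1 := fun x hx => by simp [χ, hx]
  have hχ0 : ∀ x ∉ s, χ x = 0 := fun x hx => by simp [χ, hx]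
  -- Iterates of `z ↦ 3z² - 2z³`, which fixes `0` and `1` with zero derivative and commutes with `z
  -- ↦ 1 - z`. It contracts the balls of radius `1 / 4` about both points by `7 / 8`, so the
  -- iterates converge to the indicator of `s`.
  let e : ℕ → C(X, ℂ) := fun n => (fun g => g * g + g * g + g * g - (g * g * g + g * g * g))^[n] G
  have he : ∀ n, e n ∈ A := fun n => by
    induction n with
    | zero => exact hG
    | succ n ih =>
      simp only [e, Function.iterate_succ_apply'] at ih ⊢
      have h2 := A.mul_mem ih ih
      have h3 := A.mul_mem h2 ih
      exact A.sub_mem (A.add_mem (A.add_mem h2 h2) h2) (A.add_mem h3 h3)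
  have hstep : ∀ z : ℂ, ∀ t : ℝ, t ≤ 1 / 4 → ‖z‖ ≤ t → ‖z * z * (3 - 2 * z)‖ ≤ 7 / 8 * t := by
    intro z t ht hz
    have h1 : ‖3 - 2 * z‖ ≤ 7 / 2 := by
      refine (norm_sub_le _ _).trans ?_
      simp only [norm_mul, Complex.norm_ofNat]
      linarith
    rw [norm_mul, norm_mul]
    have h0 := norm_nonneg z
    have h2 : ‖z‖ * ‖z‖ ≤ t * (1 / 4) := mul_le_mul hz (hz.trans ht) h0 (h0.trans hz)
    nlinarith [norm_nonneg (3 - 2 * z)]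
  have hest : ∀ n x, ‖e n x - χ x‖ ≤ (7 / 8) ^ n * (1 / 4) := fun n x => by
    induction n with
    | zero =>
      by_cases hx : x ∈ s
      · simpa [e, hχ1 x hx, hs] using hx
      · have : x ∈ sᶜ := hx
        rw [hsc] at this
        simpa [e, hχ0 x hx] using this
    | succ n ih =>
      have hle : (7 / 8 : ℝ) ^ n * (1 / 4) ≤ 1 / 4 := by
        have := pow_le_one₀ (n := n) (by norm_num : (0 : ℝ) ≤ 7 / 8) (by norm_num)
        linarith
      have hexp : e (n + 1) x = e n x * e n x * (3 - 2 * e n x) := by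
        simp only [e, Function.iterate_succ_apply', ContinuousMap.sub_apply,
          ContinuousMap.add_apply, ContinuousMap.mul_apply]
        ring
      rw [hexp, pow_succ']
      by_cases hx : x ∈ s
      · rw [hχ1 x hx] at ih ⊢
        have h1 := hstep (1 - e n x) _ hle (by rwa [norm_sub_rev])
        have heq : e n x * e n x * (3 - 2 * e n x) - 1 =
            -((1 - e n x) * (1 - e n x) * (3 - 2 * (1 - e n x))) := by ring
        rwa [heq, norm_neg, mul_assoc (7 / 8 : ℝ)]
      · rw [hχ0 x hx, sub_zero] at ih ⊢
        have h1 := hstep (e n x) _ hle ih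
        rwa [← mul_assoc] at h1
  have hlim : Tendsto e atTop (𝓝 χ) := by
    have h0 : Tendsto (fun n : ℕ => (7 / 8 : ℝ) ^ n * (1 / 4)) atTop (𝓝 0) := by
      rw [← zero_mul (1 / 4 : ℝ)]
      exact (tendsto_pow_atTop_nhds_zero_of_lt_one (by norm_num) (by norm_num)).mul_const _
    refine tendsto_iff_norm_sub_tendsto_zero.2 (squeeze_zero (fun _ => norm_nonneg _) (fun n => ?_) h0)
    exact (ContinuousMap.norm_le _ (by positivity)).2 fun x => hest n x
  have hχA : χ ∈ A := hA.mem_of_tendsto hlim (Eventually.of_forall he)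
  have hχχ : χ * χ = χ := by
    ext x
    by_cases hx : x ∈ s
    · simp [hχ1 x hx]
    · simp [hχ0 x hx]
  rcases hid χ hχA hχχ with h0 | h1
  · left
    intro x
    have hx : x ∈ sᶜ := fun hx => by simp [h0] at hχ1; exact hχ1 x hx
    rwa [hsc] at hx
  · right
    intro x
    have hx : x ∈ s := by
      by_contra hx
      simp [h1] at hχ0; exact hx (hχ0 x)
    rwa [hs] at hx

/-! ### The resolvent set relative to the algebra -/

/-- The complex numbers `l` such that `f - l` is invertible in `A`. -/
def resolventIn (A : Subalgebra ℂ C(X, ℂ)) (f : C(X, ℂ)) : Set ℂ :=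
  {l | ∃ g ∈ A, ∀ x, g x * (f x - l) = 1}

theorem exists_inverse_one_add (hA : IsClosed (A : Set C(X, ℂ))) {w : C(X, ℂ)} (hw : w ∈ A)
    (hw1 : ‖w‖ < 1) : ∃ g ∈ A, ∀ x, g x * (1 + w x) = 1 := by
  have hne : ∀ z ∈ Metric.ball (0 : ℂ) 1, 1 + z ≠ 0 := fun z hz h => by
    rw [add_comm, add_eq_zero_iff_eq_neg] at h
    simp [h] at hz
  obtain ⟨g, hg, hgx⟩ := exists_mem_eq_comp hA (φ := fun z => (1 + z)⁻¹)
    (DifferentiableOn.inv (by fun_prop) hne) hw hw1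
  refine ⟨g, hg, fun x => ?_⟩
  rw [hgx, inv_mul_cancel₀ (hne _ (by simpa using (w.norm_coe_le_norm x).trans_lt hw1))]

theorem mem_resolventIn_of_lt (hA : IsClosed (A : Set C(X, ℂ))) {f : C(X, ℂ)} (hf : f ∈ A) {l : ℂ}
    (hl : ‖f‖ < ‖l‖) : l ∈ resolventIn A f := by
  have h0 : 0 < ‖l‖ := (norm_nonneg f).trans_lt hl
  have hl0 : l ≠ 0 := norm_pos_iff.1 h0
  obtain ⟨g, hg, hgx⟩ := exists_inverse_one_add hA (w := (-l⁻¹) • f) (A.smul_mem hf _) (by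
    rw [norm_smul, norm_neg, norm_inv, inv_mul_lt_iff₀ h0]
    simpa using hl)
  refine ⟨(-l⁻¹) • g, A.smul_mem hg _, fun x => ?_⟩
  rw [← hgx x]
  simp
  field_simp
  ring

/-- In the supremum norm the inverse of `f - l` has norm at most `1 / c`, so the Neumann series
reaches a radius that depends only on the values of `f`, not on `A`. -/
theorem mem_resolventIn_of_dist (hA : IsClosed (A : Set C(X, ℂ))) {f : C(X, ℂ)}
    {l l' : ℂ} (hl : l ∈ resolventIn A f) {c : ℝ} (hc : ∀ x, c ≤ ‖f x - l‖)
    (hl' : ‖l' - l‖ < c) : l' ∈ resolventIn A f := by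
  obtain ⟨g, hg, hgx⟩ := hl
  have hc0 : 0 < c := (norm_nonneg _).trans_lt hl'
  have hgn : ‖g‖ ≤ c⁻¹ := (ContinuousMap.norm_le _ (by positivity)).2 fun x => by
    have h1 : ‖g x‖ * ‖f x - l‖ = 1 := by rw [← norm_mul, hgx, norm_one]
    have h2 : ‖f x - l‖ ≠ 0 := fun h => by simp [h] at h1
    rw [eq_inv_of_mul_eq_one_left h1]
    gcongr
    exact hc x
  obtain ⟨k, hk, hkx⟩ := exists_inverse_one_add hA (w := (l - l') • g) (A.smul_mem hg _) (by
    rw [norm_smul, norm_sub_rev]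
    calc ‖l' - l‖ * ‖g‖ ≤ ‖l' - l‖ * c⁻¹ := by gcongr
      _ < c * c⁻¹ := by gcongr
      _ = 1 := mul_inv_cancel₀ hc0.ne')
  refine ⟨k * g, A.mul_mem hk hg, fun x => ?_⟩
  have h1 := hkx x
  have h2 := hgx x
  simp only [ContinuousMap.smul_apply, ContinuousMap.mul_apply, smul_eq_mul] at h1 ⊢
  linear_combination h1 + k x * h2

theorem exists_le_norm_sub {f : C(X, ℂ)} {l : ℂ} (hl : l ∉ range f) :
    ∃ c > 0, ∀ x, c ≤ ‖f x - l‖ := by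
  have hcl : IsClosed (range f) := (isCompact_range f.continuous).isClosed
  obtain ⟨c, hc, hcs⟩ := Metric.isOpen_iff.1 hcl.isOpen_compl l hl
  refine ⟨c, hc, fun x => ?_⟩
  by_contra! h
  exact hcs (by simpa [dist_eq_norm] using h) (mem_range_self x)

omit [CompactSpace X] in
theorem notMem_range_of_mem_resolventIn {f : C(X, ℂ)} {l : ℂ} (hl : l ∈ resolventIn A f) :
    l ∉ range f := by
  rintro ⟨x, rfl⟩
  obtain ⟨g, -, hg⟩ := hl
  simpa using hg x

theorem isOpen_resolventIn (hA : IsClosed (A : Set C(X, ℂ))) (f : C(X, ℂ)) :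
    IsOpen (resolventIn A f) := by
  refine Metric.isOpen_iff.2 fun l hl => ?_
  obtain ⟨c, hc, hcx⟩ := exists_le_norm_sub (notMem_range_of_mem_resolventIn hl)
  exact ⟨c, hc, fun l' hl' => mem_resolventIn_of_dist hA hl hcx (by
    simpa [dist_eq_norm] using hl')⟩

/-- At a point off the range, nearby resolvent points have a Neumann radius bounded below by half
the distance to the range, and this radius reaches the point itself. -/
theorem mem_range_of_mem_closure_resolventIn (hA : IsClosed (A : Set C(X, ℂ))) {f : C(X, ℂ)}
    {z : ℂ} (hz : z ∈ closure (resolventIn A f)) (hz' : z ∉ resolventIn A f) : z ∈ range f := by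
  by_contra hr
  obtain ⟨c, hc, hcx⟩ := exists_le_norm_sub hr
  obtain ⟨l, hl, hlz⟩ := Metric.mem_closure_iff.1 hz (c / 2) (half_pos hc)
  rw [dist_eq_norm] at hlz
  refine hz' (mem_resolventIn_of_dist hA hl (c := c / 2) (fun x => ?_) hlz)
  have h1 := hcx x
  have h2 := norm_sub_le_norm_sub_add_norm_sub (f x) l z
  rw [norm_sub_rev l z] at h2
  linarith

end ClosedSubalgebra

theorem IsPreconnected.inter_frontier_nonempty_of_mem {Y : Type*} [TopologicalSpace Y] {s t : Set Y}
    (ht : IsPreconnected t) {x y : Y} (hx : x ∈ t) (hxs : x ∈ s) (hy : y ∈ t) (hys : y ∉ s) :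
    (t ∩ frontier s).Nonempty := by
  by_contra hemp
  rw [not_nonempty_iff_eq_empty, ← disjoint_iff_inter_eq_empty] at hemp
  have hsub : t ⊆ interior s ∪ (closure s)ᶜ := fun z hz => by
    by_cases h : z ∈ interior s
    · exact Or.inl h
    · exact Or.inr fun hc => disjoint_left.1 hemp hz ⟨hc, h⟩
  have hxi : x ∈ interior s := (hsub hx).resolve_right fun h => h (subset_closure hxs)
  have := ht.subset_left_of_subset_union isOpen_interior isClosed_closure.isOpen_compl
    (disjoint_compl_right.mono_left (interior_subset.trans subset_closure)) hsub ⟨x, hx, hxi⟩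
  exact hys (interior_subset (this hy))

section ClosedSubalgebra

variable {X : Type*} [TopologicalSpace X] [CompactSpace X] {A : Subalgebra ℂ C(X, ℂ)}

/-- The unbounded component of the resolvent set. -/
theorem exists_outer_resolvent (hA : IsClosed (A : Set C(X, ℂ))) {f : C(X, ℂ)} (hf : f ∈ A) :
    ∃ Ω : Set ℂ, IsOpen Ω ∧ IsPreconnected Ω ∧ Ω ⊆ resolventIn A f ∧
      (∀ l : ℂ, ‖f‖ < ‖l‖ → l ∈ Ω) ∧ frontier Ω ⊆ range f := by
  have hopen := isOpen_resolventIn hA f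
  have hΩo : IsOpen (connectedComponentIn (resolventIn A f) ((‖f‖ + 1 : ℝ) : ℂ)) :=
    hopen.connectedComponentIn
  have hmem : ∀ a : ℝ, ‖f‖ < a → (a : ℂ) ∈ resolventIn A f := fun a ha =>
    mem_resolventIn_of_lt hA hf (by
      rwa [Complex.norm_of_nonneg ((norm_nonneg f).trans ha.le)])
  refine ⟨_, hΩo, isPreconnected_connectedComponentIn, connectedComponentIn_subset _ _,
    fun l hl => ?_, fun z hz => ?_⟩
  · have h1 : IsPreconnected (Metric.sphere (0 : ℂ) ‖l‖) :=
      isPreconnected_sphere (by simp [Complex.rank_real_complex]) _ _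
    have h2 : IsPreconnected ((fun a : ℝ => (a : ℂ)) '' Ioi ‖f‖) :=
      isPreconnected_Ioi.image _ (by fun_prop)
    have hne : (((fun a : ℝ => (a : ℂ)) '' Ioi ‖f‖) ∩ Metric.sphere (0 : ℂ) ‖l‖).Nonempty :=
      ⟨(‖l‖ : ℂ), ⟨‖l‖, hl, rfl⟩, by simp⟩
    -- The circle through `l` together with the real ray beyond `‖f‖` is a connected subset of the
    -- resolvent set.
    have h3 := h2.union' hne h1
    refine h3.subset_connectedComponentIn (Or.inl ⟨‖f‖ + 1, by simp, by simp⟩) ?_ (Or.inr (by simp))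
    rintro w (⟨a, ha, rfl⟩ | hw)
    · exact hmem a ha
    · exact mem_resolventIn_of_lt hA hf (by simpa [mem_sphere_zero_iff_norm.1 hw] using hl)
  · refine mem_range_of_mem_closure_resolventIn hA
      (closure_mono (connectedComponentIn_subset _ _) (frontier_subset_closure hz)) fun hzR => ?_
    obtain ⟨c, hc, hcs⟩ := Metric.isOpen_iff.1 hopen z hzR
    obtain ⟨w, hw, hwz⟩ := Metric.mem_closure_iff.1 (frontier_subset_closure hz) c hc
    rw [hΩo.frontier_eq] at hz
    refine hz.2 ?_
    rw [connectedComponentIn_eq hw]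
    exact (convex_ball z c).isPreconnected.subset_connectedComponentIn
      (by simpa [dist_comm] using hwz) hcs (Metric.mem_ball_self hc)

/-! ### Square roots of quotients and peaking functions -/

/-- Both the root and its inverse are needed because the induction along a connected set in
`exists_sqrt_quotient` compares neighbouring points in both orders. -/
theorem exists_sqrt_near (hA : IsClosed (A : Set C(X, ℂ))) {w : C(X, ℂ)} (hw : w ∈ A)
    (hw1 : ‖w‖ < 1) : ∃ t ∈ A, ∃ s ∈ A, (∀ x, t x ^ 2 = 1 + w x) ∧ (∀ x, s x ^ 2 * (1 + w x) = 1) ∧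
      (∀ x, 0 < (t x).re) ∧ ∀ x, 0 < (s x).re := by
  have hre : ∀ z ∈ Metric.ball (0 : ℂ) 1, 0 < (1 + z).re := fun z hz => by
    have := (abs_lt.1 ((Complex.abs_re_le_norm z).trans_lt (by simpa using hz))).1
    simp
    linarith
  have hdiff : ∀ c : ℂ, DifferentiableOn ℂ (fun z => Complex.exp (c * Complex.log (1 + z)))
      (Metric.ball 0 1) := fun c =>
    ((DifferentiableOn.clog (by fun_prop) fun z hz => Or.inl (hre z hz)).const_mul c).cexp
  obtain ⟨t, ht, htx⟩ := exists_mem_eq_comp hA (hdiff (1 / 2)) hw hw1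
  obtain ⟨s, hs, hsx⟩ := exists_mem_eq_comp hA (hdiff (-1 / 2)) hw hw1
  have hwx : ∀ x, w x ∈ Metric.ball (0 : ℂ) 1 := fun x => by
    simpa using (w.norm_coe_le_norm x).trans_lt hw1
  have hne : ∀ x, 1 + w x ≠ 0 := fun x h => by simpa [h] using hre _ (hwx x)
  have hpos : ∀ (c : ℝ) (x : X), |c| ≤ 1 →
      0 < (Complex.exp (c * Complex.log (1 + w x))).re := fun c x hc => by
    have harg := Complex.abs_arg_lt_pi_div_two_iff.2 (Or.inl (hre _ (hwx x)))
    rw [Complex.exp_re]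
    refine mul_pos (Real.exp_pos _) (Real.cos_pos_of_mem_Ioo (abs_lt.1 ?_))
    rw [Complex.im_ofReal_mul, Complex.log_im, abs_mul]
    exact (mul_le_of_le_one_left (abs_nonneg _) hc).trans_lt harg
  refine ⟨t, ht, s, hs, fun x => ?_, fun x => ?_, fun x => ?_, fun x => ?_⟩
  · rw [htx, ← Complex.exp_nat_mul]
    conv_rhs => rw [← Complex.exp_log (hne x)]
    congr 1
    push_cast
    ring
  · rw [hsx, ← Complex.exp_nat_mul]
    nth_rewrite 2 [← Complex.exp_log (hne x)]
    rw [← Complex.exp_add]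
    refine Eq.trans (congrArg _ ?_) Complex.exp_zero
    push_cast
    ring
  · rw [htx]
    simpa using hpos (1 / 2) x (by norm_num [abs_le])
  · rw [hsx]
    simpa using hpos (-1 / 2) x (by norm_num [abs_le])

/-- A square root of `(f - p) / (f - q)` when `p` and `q` are joined in the resolvent set by a
connected set of radius at most `r`; it is the principal one far from that set. -/
theorem exists_sqrt_quotient (hA : IsClosed (A : Set C(X, ℂ))) {f : C(X, ℂ)} {Γ : Set ℂ}
    (hΓ : IsPreconnected Γ) (hΓA : Γ ⊆ resolventIn A f) {z : ℂ} {r : ℝ} (hr : 0 < r)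
    (hΓr : ∀ l ∈ Γ, ‖l - z‖ ≤ r) {p q : ℂ} (hp : p ∈ Γ) (hq : q ∈ Γ) :
    ∃ t ∈ A, (∀ x, t x ^ 2 * (f x - q) = f x - p) ∧ ∀ x, 4 * r ≤ ‖f x - z‖ → 0 < (t x).re := by
  refine hΓ.induction₂' (fun p q => ∃ t ∈ A, (∀ x, t x ^ 2 * (f x - q) = f x - p) ∧
    ∀ x, 4 * r ≤ ‖f x - z‖ → 0 < (t x).re) (fun l hl => ?_) ?_ hp hq
  · obtain ⟨g, hg, hgx⟩ := hΓA hl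
    have hlim : Tendsto (fun y : ℂ => ‖(l - y) • g‖) (𝓝[Γ] l) (𝓝 0) := by
      have : ContinuousAt (fun y : ℂ => ‖(l - y) • g‖) l := by fun_prop
      simpa [ContinuousAt] using this.tendsto.mono_left nhdsWithin_le_nhds
    filter_upwards [hlim.eventually_lt_const one_pos] with y hy
    obtain ⟨t, ht, s, hs, htx, hsx, htr, hsr⟩ := exists_sqrt_near hA (A.smul_mem hg _) hy
    refine ⟨⟨s, hs, fun x => ?_, fun x _ => hsr x⟩, ⟨t, ht, fun x => ?_, fun x _ => htr x⟩⟩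
    · have h1 := hsx x
      have h2 := hgx x
      simp only [ContinuousMap.smul_apply, smul_eq_mul] at h1
      linear_combination (f x - l) * h1 - s x ^ 2 * (l - y) * h2
    · have h1 := htx x
      have h2 := hgx x
      simp only [ContinuousMap.smul_apply, smul_eq_mul] at h1
      linear_combination (f x - l) * h1 + (l - y) * h2
  · rintro a b c ha hb hc ⟨t, ht, htx, htr⟩ ⟨s, hs, hsx, hsr⟩
    refine ⟨t * s, A.mul_mem ht hs, fun x => ?_, fun x hx => ?_⟩
    · have h1 := htx x
      have h2 := hsx x
      simp only [ContinuousMap.mul_apply]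
      linear_combination t x ^ 2 * h2 + h1
    -- Far from `z` the quotient is within distance `1` of `1`, so a root with positive real part
    -- lies in the sector `|im| < re`. The product of two numbers from this sector again has
    -- positive real part.
    · have key : ∀ (u : ℂ) (a b : ℂ), a ∈ Γ → b ∈ Γ → u ^ 2 * (f x - b) = f x - a → 0 < u.re →
          |u.im| < u.re := fun u a b ha hb hu hure => by
        have h3 : 3 * r ≤ ‖f x - b‖ := by
          have := norm_sub_le_norm_sub_add_norm_sub (f x) b z
          have := hΓr b hb
          linarith
        have h4 : ‖b - a‖ ≤ 2 * r := by
          have := norm_sub_le_norm_sub_add_norm_sub b z a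
          have := hΓr b hb
          have := hΓr a ha
          rw [norm_sub_rev] at this
          linarith
        have hne : f x - b ≠ 0 := norm_pos_iff.1 (by linarith)
        have h5 : ‖u ^ 2 - 1‖ < 1 := by
          have : u ^ 2 - 1 = (b - a) / (f x - b) := by
            field_simp
            linear_combination hu
          rw [this, norm_div, div_lt_one (norm_pos_iff.2 hne)]
          linarith
        have h6 := (abs_lt.1 ((Complex.abs_re_le_norm _).trans_lt h5)).1
        simp only [pow_two, Complex.sub_re, Complex.mul_re, Complex.one_re] at h6
        exact abs_lt_of_sq_lt_sq (by nlinarith) hure.le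
      have h1 := abs_lt.1 (key _ a b ha hb (htx x) (htr x hx))
      have h2 := abs_lt.1 (key _ b c hb hc (hsx x) (hsr x hx))
      simp only [ContinuousMap.mul_apply, Complex.mul_re]
      nlinarith

/-- A connected piece of `Ω` that starts at `p` and reaches the sphere of radius `r` around `z`. -/
theorem exists_preconnected_to_sphere {Ω : Set ℂ} (hΩ : IsOpen Ω) (hΩc : IsPreconnected Ω)
    {z p q : ℂ} {r : ℝ} (hp : p ∈ Ω) (hpz : ‖p - z‖ < r) (hq : q ∈ Ω) (hqz : r ≤ ‖q - z‖) :
    ∃ Γ ⊆ Ω, IsPreconnected Γ ∧ p ∈ Γ ∧ (∀ l ∈ Γ, ‖l - z‖ ≤ r) ∧ ∃ l ∈ Γ, ‖l - z‖ = r := by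
  have hjoin := (hΩ.isConnected_iff_isPathConnected.1 ⟨⟨p, hp⟩, hΩc⟩).joinedIn p hp q hq
  obtain ⟨γ, hγ⟩ := hjoin
  let ρ : ℝ → ℝ := fun s => ‖γ.extend s - z‖
  have hρ : Continuous ρ := by fun_prop
  have hcl : IsCompact (Icc (0 : ℝ) 1 ∩ {s | r ≤ ρ s}) :=
    isCompact_Icc.inter_right (isClosed_le continuous_const hρ)
  -- `τ` is the first time at which the path reaches the sphere; the path is stopped there.
  obtain ⟨τ, ⟨hτ, hτr⟩, hmin⟩ := hcl.exists_isLeast ⟨1, by simp, by simpa [ρ] using hqz⟩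
  have hlt : ∀ s ∈ Ico 0 τ, ρ s < r := fun s hs => by
    by_contra! h
    exact absurd (hmin ⟨⟨hs.1, hs.2.le.trans hτ.2⟩, h⟩) (not_le.2 hs.2)
  have hτ0 : 0 < τ := by
    refine lt_of_le_of_ne hτ.1 fun h => ?_
    rw [← h] at hτr
    have : ρ 0 = ‖p - z‖ := by simp [ρ]
    exact absurd hτr (by simpa [this] using hpz)
  have hle : ∀ s ∈ Icc 0 τ, ρ s ≤ r := by
    rw [← closure_Ico hτ0.ne]
    intro s hs
    exact closure_minimal (fun s hs => (hlt s hs).le) (isClosed_le hρ continuous_const) hs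
  refine ⟨γ.extend '' Icc 0 τ, ?_, isPreconnected_Icc.image _ (by fun_prop),
    ⟨0, ⟨le_rfl, hτ.1⟩, by simp⟩, ?_, γ.extend τ, ⟨τ, ⟨hτ.1, le_rfl⟩, rfl⟩,
    le_antisymm (hle τ ⟨hτ.1, le_rfl⟩) hτr⟩
  · rintro _ ⟨s, hs, rfl⟩
    rw [Path.extend_apply _ ⟨hs.1, hs.2.trans hτ.2⟩]
    exact hγ _
  · rintro _ ⟨s, hs, rfl⟩
    exact hle s hs

/-- Boundary points of an open connected unbounded part of the resolvent set of `f` are peak values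
of `f`, with a uniform bound on the peaking functions. -/
theorem exists_peaking (hA : IsClosed (A : Set C(X, ℂ))) {f : C(X, ℂ)} (hf : f ∈ A)
    {Ω : Set ℂ} (hΩ : IsOpen Ω) (hΩc : IsPreconnected Ω) (hΩA : Ω ⊆ resolventIn A f)
    (hΩf : ∀ l : ℂ, ‖f‖ < ‖l‖ → l ∈ Ω) {z : ℂ} (hz : z ∈ frontier Ω) {δ ε : ℝ} (hδ : 0 < δ)
    (hε : 0 < ε) (hε1 : ε ≤ 1) :
    ∃ F ∈ A, (∀ x, ‖F x‖ ≤ 40) ∧ (∀ x, δ ≤ ‖f x - z‖ → ‖F x‖ ≤ ε) ∧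
      ∀ x, f x = z → ‖F x - 1‖ ≤ ε := by
  -- The scale `r` makes `|F| ≤ 2r / |f - q|` smaller than `ε` at distance `δ` from `z`. The choice
  -- of `p` within `(ε / 4) ^ 2 * r` of `z` makes `|t| < ε / 4` where `f = z`.
  obtain ⟨r, hr⟩ : ∃ r : ℝ, r = δ * ε / 8 := ⟨_, rfl⟩
  have hr0 : 0 < r := by rw [hr]; positivity
  have hrδ : 8 * r ≤ δ := by rw [hr]; nlinarith
  obtain ⟨p, hp, hpz⟩ := Metric.mem_closure_iff.1 (frontier_subset_closure hz) ((ε / 4) ^ 2 * r)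
    (by positivity)
  rw [dist_comm, dist_eq_norm] at hpz
  have hε16 : (ε / 4) ^ 2 * r ≤ r / 16 := by nlinarith
  have hq0 : ((‖f‖ + 1 + ‖z‖ + r : ℝ) : ℂ) ∈ Ω := hΩf _ (by
    rw [Complex.norm_of_nonneg (by positivity)]
    have := norm_nonneg z
    linarith)
  obtain ⟨Γ, hΓΩ, hΓ, hpΓ, hΓr, q, hqΓ, hqz⟩ := exists_preconnected_to_sphere hΩ hΩc hp
    (by linarith) hq0 (r := r) (z := z) (by
      have h1 := norm_sub_norm_le ((‖f‖ + 1 + ‖z‖ + r : ℝ) : ℂ) z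
      rw [Complex.norm_of_nonneg (by positivity)] at h1
      have := norm_nonneg f
      linarith)
  obtain ⟨t, ht, htx, htr⟩ := exists_sqrt_quotient hA hΓ (hΓΩ.trans hΩA) hr0 hΓr hpΓ hqΓ
  have hD1 : r / 2 ≤ ‖p - q‖ := by
    have := norm_sub_le_norm_sub_add_norm_sub q p z
    rw [norm_sub_rev q p] at this
    linarith
  have hD2 : ‖p - q‖ ≤ 2 * r := by
    have := norm_sub_le_norm_sub_add_norm_sub p z q
    rw [norm_sub_rev z q] at this
    linarith
  have hD0 : 0 < ‖p - q‖ := by linarith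
  have hD : p - q ≠ 0 := norm_pos_iff.1 hD0
  -- Since `1 - t ^ 2 = (p - q) / (f - q)`, this is `(1 - t) / (1 + t)` wherever `1 + t ≠ 0`,
  -- written without that division: near `1` where `t` is near `0`, near `0` where `t` is near `1`.
  obtain ⟨F, hF⟩ : ∃ F : C(X, ℂ), F = (p - q)⁻¹ • ((1 - t) * (1 - t) * (f - algebraMap ℂ _ q)) :=
    ⟨_, rfl⟩
  have hFx : ∀ x, F x * (p - q) = (1 - t x) ^ 2 * (f x - q) := fun x => by
    simp [hF]
    field_simp
  have hFt : ∀ x, F x * (1 + t x) = 1 - t x := fun x => by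
    apply mul_right_cancel₀ hD
    linear_combination (1 + t x) * hFx x - (1 - t x) * htx x
  have hF1 : ∀ x, ‖F x‖ * ‖p - q‖ = ‖1 - t x‖ ^ 2 * ‖f x - q‖ := fun x => by
    rw [← norm_mul, hFx, norm_mul, norm_pow]
  have hfq : ∀ x, ‖f x - z‖ - r ≤ ‖f x - q‖ := fun x => by
    have := norm_sub_le_norm_sub_add_norm_sub (f x) q z
    linarith
  have hfar : ∀ x, 4 * r ≤ ‖f x - z‖ → ‖F x‖ * ‖f x - q‖ ≤ 2 * r := fun x hx => by
    have h1 : 1 ≤ ‖1 + t x‖ := by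
      have h2 := Complex.re_le_norm (1 + t x)
      have h3 := htr x hx
      simp only [Complex.add_re, Complex.one_re] at h2
      linarith
    have h2 : ‖F x‖ ≤ ‖1 - t x‖ := by
      rw [← hFt x, norm_mul]
      exact le_mul_of_one_le_right (norm_nonneg _) h1
    have h3 : ‖1 - t x‖ * ‖1 + t x‖ * ‖f x - q‖ = ‖p - q‖ := by
      rw [← norm_mul, ← norm_mul]
      congr 1
      linear_combination -htx x
    have h4 : ‖1 - t x‖ ≤ ‖1 - t x‖ * ‖1 + t x‖ := le_mul_of_one_le_right (norm_nonneg _) h1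
    calc ‖F x‖ * ‖f x - q‖ ≤ ‖1 - t x‖ * ‖1 + t x‖ * ‖f x - q‖ := by
          gcongr
          exact h2.trans h4
      _ ≤ 2 * r := h3.trans_le hD2
  refine ⟨F, ?_, fun x => ?_, fun x hx => ?_, fun x hx => ?_⟩
  · rw [hF]
    exact A.smul_mem (A.mul_mem (A.mul_mem (A.sub_mem A.one_mem ht) (A.sub_mem A.one_mem ht))
      (A.sub_mem hf (A.algebraMap_mem _))) _
  · by_cases hx : 4 * r ≤ ‖f x - z‖
    · have h1 := hfar x hx
      have h2 := hfq x
      by_contra! h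
      nlinarith
    -- Close to `z` the branch of the root is not controlled. The bound `|1 - t| ^ 2 ≤ 2 + 2|t| ^ 2`
    -- involves only `|t| ^ 2`, and `40` arises as `20 * r` over `r / 2 ≤ ‖p - q‖`.
    · have h1 : ‖f x - q‖ ≤ 5 * r := by
        have := norm_sub_le_norm_sub_add_norm_sub (f x) z q
        rw [norm_sub_rev z q] at this
        linarith
      have h2 : ‖f x - p‖ ≤ 5 * r := by
        have := norm_sub_le_norm_sub_add_norm_sub (f x) z p
        rw [norm_sub_rev z p] at this
        linarith
      have h3 : ‖t x‖ ^ 2 * ‖f x - q‖ = ‖f x - p‖ := by rw [← norm_pow, ← norm_mul, htx]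
      have h4 : ‖1 - t x‖ ^ 2 ≤ 2 + 2 * ‖t x‖ ^ 2 := by
        have h5 := norm_sub_le 1 (t x)
        rw [norm_one] at h5
        nlinarith [norm_nonneg (1 - t x), sq_nonneg (1 - ‖t x‖)]
      have h6 : ‖F x‖ * ‖p - q‖ ≤ 20 * r := by
        rw [hF1]
        calc ‖1 - t x‖ ^ 2 * ‖f x - q‖ ≤ (2 + 2 * ‖t x‖ ^ 2) * ‖f x - q‖ := by gcongr
          _ = 2 * ‖f x - q‖ + 2 * ‖f x - p‖ := by rw [← h3]; ring
          _ ≤ 20 * r := by linarith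
      by_contra! h
      nlinarith
  · have h1 := hfar x (by linarith)
    have h2 := hfq x
    by_contra! h
    have h3 : 7 / 8 * δ ≤ ‖f x - q‖ := by linarith
    have h4 : ε * (7 / 8 * δ) ≤ ‖F x‖ * ‖f x - q‖ := by gcongr
    rw [hr] at h1
    nlinarith [mul_pos hδ hε]
  · have h1 : ‖t x‖ ^ 2 * r < (ε / 4) ^ 2 * r := by
      have := congrArg norm (htx x)
      rw [norm_mul, norm_pow, hx, norm_sub_rev z q, hqz, norm_sub_rev z p] at this
      rwa [this]
    have h2 : ‖t x‖ < ε / 4 :=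
      lt_of_pow_lt_pow_left₀ 2 (by positivity) (lt_of_mul_lt_mul_right h1 hr0.le)
    have h3 : ‖F x - 1‖ * ‖1 + t x‖ = 2 * ‖t x‖ := by
      rw [← norm_mul, show (F x - 1) * (1 + t x) = -(2 * t x) by linear_combination hFt x]
      simp
    have h4 : 3 / 4 ≤ ‖1 + t x‖ := by
      have := norm_sub_le (1 + t x) (t x)
      rw [add_sub_cancel_right, norm_one] at this
      linarith
    by_contra! h
    nlinarith

/-! ### Weak peak sets -/

/-- `P` is a limit of peak sets of `A`, with peaking functions bounded by a constant `C`. -/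
def IsWeakPeakSet (A : Subalgebra ℂ C(X, ℂ)) (C : ℝ) (P : Set X) : Prop :=
  ∀ V, IsOpen V → P ⊆ V → ∀ ε > 0, ∃ F ∈ A, (∀ x, ‖F x‖ < C + ε) ∧ (∀ x ∉ V, ‖F x‖ < ε) ∧
    ∀ x ∈ P, ‖F x - 1‖ < ε

theorem isWeakPeakSet_preimage_singleton (hA : IsClosed (A : Set C(X, ℂ))) {f : C(X, ℂ)}
    (hf : f ∈ A) {Ω : Set ℂ} (hΩ : IsOpen Ω) (hΩc : IsPreconnected Ω) (hΩA : Ω ⊆ resolventIn A f)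
    (hΩf : ∀ l : ℂ, ‖f‖ < ‖l‖ → l ∈ Ω) {z : ℂ} (hz : z ∈ frontier Ω) :
    IsWeakPeakSet A 40 (f ⁻¹' {z}) := by
  intro V hV hPV ε hε
  obtain ⟨δ, hδ, hδV⟩ : ∃ δ > 0, ∀ x ∉ V, δ ≤ ‖f x - z‖ := by
    rcases Vᶜ.eq_empty_or_nonempty with he | hne
    · exact ⟨1, one_pos, fun x hx => absurd (show x ∈ Vᶜ from hx) (by simp [he])⟩
    · obtain ⟨x, hx, hmin⟩ := hV.isClosed_compl.isCompact.exists_isMinOn hne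
        (f := fun x => ‖f x - z‖) (by fun_prop)
      refine ⟨‖f x - z‖, norm_pos_iff.2 fun h => hx (hPV ?_), fun y hy => hmin hy⟩
      simpa [sub_eq_zero] using h
  have hε' : 0 < min (ε / 2) 1 := by positivity
  have hlt : min (ε / 2) 1 < ε := (min_le_left _ _).trans_lt (half_lt_self hε)
  obtain ⟨F, hF, h1, h2, h3⟩ := exists_peaking hA hf hΩ hΩc hΩA hΩf hz hδ hε' (min_le_right _ _)
  exact ⟨F, hF, fun x => by linarith [h1 x], fun x hx => (h2 x (hδV x hx)).trans_lt hlt,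
    fun x hx => (h3 x hx).trans_lt hlt⟩

theorem norm_half_mul_one_add_lt {u : ℂ} (hu : ‖u‖ ≤ 1) (hu1 : u ≠ 1) : ‖(1 / 2) * (1 + u)‖ < 1 := by
  have h1 : u.re * u.re + u.im * u.im ≤ 1 := by
    rw [← Complex.normSq_apply, Complex.normSq_eq_norm_sq]
    exact pow_le_one₀ (norm_nonneg _) hu
  have hre : u.re < 1 := by
    by_contra! h
    have h2 : u.re = 1 := by nlinarith [mul_self_nonneg u.im]
    have h3 : u.im = 0 := by nlinarith
    exact hu1 (Complex.ext (by simpa using h2) (by simpa using h3))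
  have h4 : ‖1 + u‖ ^ 2 < 2 ^ 2 := by
    rw [← Complex.normSq_eq_norm_sq, Complex.normSq_apply]
    simp
    nlinarith
  have h5 := lt_of_pow_lt_pow_left₀ 2 (by norm_num) h4
  rw [norm_mul]
  norm_num
  linarith

/-- The maximum modulus argument: on a weak peak set, every element of the algebra takes some
value on a smaller weak peak set. -/
theorem IsWeakPeakSet.exists_inter_preimage {C : ℝ} (hC : 0 ≤ C) {P : Set X}
    (hP : IsWeakPeakSet A C P) (hPc : IsClosed P) (hPn : P.Nonempty) {g : C(X, ℂ)} (hg : g ∈ A) :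
    ∃ w, (P ∩ g ⁻¹' {w}).Nonempty ∧ IsWeakPeakSet A C (P ∩ g ⁻¹' {w}) := by
  obtain ⟨x₀, hx₀, hmax⟩ := hPc.isCompact.exists_isMaxOn hPn (f := fun x => ‖g x‖) (by fun_prop)
  refine ⟨g x₀, ⟨x₀, hx₀, rfl⟩, ?_⟩
  rcases eq_or_ne (g x₀) 0 with h0 | h0
  · have : P ∩ g ⁻¹' {g x₀} = P := inter_eq_left.2 fun x hx => by
      have h1 : ‖g x‖ ≤ ‖g x₀‖ := hmax hx
      rw [h0, norm_zero] at h1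
      simpa [h0] using h1
    rwa [this]
  -- On `P`, `k` equals `1` where `g` takes its value of largest modulus `g x₀`, and `|k| < 1`
  -- elsewhere.
  obtain ⟨k, hk⟩ : ∃ k : C(X, ℂ), k = (1 / 2 : ℂ) • (1 + (g x₀)⁻¹ • g) := ⟨_, rfl⟩
  have hkA : k ∈ A := hk ▸ A.smul_mem (A.add_mem A.one_mem (A.smul_mem hg _)) _
  have hkx : ∀ x, k x = 1 / 2 * (1 + (g x₀)⁻¹ * g x) := fun x => by
    simp [hk]
    ring
  have hk1 : ∀ x, g x = g x₀ → k x = 1 := fun x hx => by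
    rw [hkx, hx, inv_mul_cancel₀ h0]
    norm_num
  have hklt : ∀ x ∈ P, g x ≠ g x₀ → ‖k x‖ < 1 := fun x hx hne => by
    rw [hkx]
    refine norm_half_mul_one_add_lt ?_ fun h => hne ?_
    · rw [norm_mul, norm_inv, inv_mul_le_iff₀ (norm_pos_iff.2 h0), mul_one]
      exact hmax hx
    · rwa [inv_mul_eq_one₀ h0, eq_comm] at h
  have hkle : ∀ x ∈ P, ‖k x‖ ≤ 1 := fun x hx => by
    by_cases h : g x = g x₀
    · rw [hk1 x h, norm_one]
    · exact (hklt x hx h).le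
  intro V hV hPV ε hε
  obtain ⟨ρ, hρ0, hρ1, hρ⟩ : ∃ ρ : ℝ, 0 ≤ ρ ∧ ρ < 1 ∧ ∀ x ∈ P \ V, ‖k x‖ ≤ ρ := by
    rcases (P \ V).eq_empty_or_nonempty with he | hne
    · exact ⟨0, le_rfl, one_pos, by simp [he]⟩
    · obtain ⟨x, hx, hm⟩ := (hPc.sdiff hV).isCompact.exists_isMaxOn hne
        (f := fun x => ‖k x‖) (by fun_prop)
      exact ⟨‖k x‖, norm_nonneg _, hklt x hx.1 fun h => hx.2 (hPV ⟨hx.1, h⟩), fun y hy => hm hy⟩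
  obtain ⟨ε₁, hε₁⟩ : ∃ ε₁ : ℝ, ε₁ = ε / (2 * (C + 1)) := ⟨_, rfl⟩
  have hε₁0 : 0 < ε₁ := by rw [hε₁]; positivity
  have hε₁C : (C + 1) * ε₁ = ε / 2 := by
    rw [hε₁]
    field_simp
  obtain ⟨N, hN⟩ := exists_pow_lt_of_lt_one hε₁0 hρ1
  -- `F` is chosen after `k ^ N` and peaks inside `W`, where `k ^ N` barely exceeds `1`. Thus the
  -- product keeps the same constant `C`, as the passage to a minimal set requires.
  let W : Set X := {x | ‖(k ^ N) x‖ < 1 + ε₁} ∩ (V ∪ {x | ‖(k ^ N) x‖ < ε₁})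
  have hW : IsOpen W := (isOpen_lt (by fun_prop) continuous_const).inter
    (hV.union (isOpen_lt (by fun_prop) continuous_const))
  have hPW : P ⊆ W := fun x hx => by
    have h1 : ‖k x ^ N‖ ≤ 1 := by
      rw [norm_pow]
      exact pow_le_one₀ (norm_nonneg _) (hkle x hx)
    refine ⟨by simpa using h1.trans_lt (by linarith), ?_⟩
    by_cases hxV : x ∈ V
    · exact Or.inl hxV
    · refine Or.inr ?_
      simp only [mem_ofPred_eq, ContinuousMap.pow_apply, norm_pow]
      exact (pow_le_pow_left₀ (norm_nonneg _) (hρ x ⟨hx, hxV⟩) N).trans_lt hN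
  obtain ⟨ε₂, hε₂⟩ : ∃ ε₂ : ℝ, ε₂ = min 1 (min (ε / 4) (ε / (2 * (‖k ^ N‖ + 1)))) := ⟨_, rfl⟩
  have hε₂0 : 0 < ε₂ := by rw [hε₂]; positivity
  have hε₂1 : ε₂ ≤ 1 := hε₂ ▸ min_le_left _ _
  have hε₂4 : ε₂ ≤ ε / 4 := hε₂ ▸ (min_le_right _ _).trans (min_le_left _ _)
  have hε₂N : ε₂ * ‖k ^ N‖ < ε := by
    have h1 : ε₂ ≤ ε / (2 * (‖k ^ N‖ + 1)) := hε₂ ▸ (min_le_right _ _).trans (min_le_right _ _)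
    rw [le_div_iff₀ (by positivity)] at h1
    nlinarith [norm_nonneg (k ^ N)]
  obtain ⟨F, hF, hF1, hF2, hF3⟩ := hP W hW hPW ε₂ hε₂0
  have hout : ∀ x ∉ W, ‖(F * k ^ N) x‖ < ε := fun x hx => by
    rw [ContinuousMap.mul_apply, norm_mul]
    refine lt_of_le_of_lt ?_ hε₂N
    exact mul_le_mul (hF2 x hx).le ((k ^ N).norm_coe_le_norm x) (norm_nonneg _) hε₂0.le
  refine ⟨F * k ^ N, A.mul_mem hF (A.pow_mem hkA N), fun x => ?_, fun x hx => ?_, fun x hx => ?_⟩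
  · by_cases hxW : x ∈ W
    · rw [ContinuousMap.mul_apply, norm_mul]
      have h1 : ‖(k ^ N) x‖ < 1 + ε₁ := hxW.1
      have h2 : ‖F x‖ * ‖(k ^ N) x‖ ≤ (C + ε₂) * (1 + ε₁) :=
        mul_le_mul (hF1 x).le h1.le (norm_nonneg _) (by positivity)
      nlinarith
    · linarith [hout x hxW]
  · by_cases hxW : x ∈ W
    · have h1 : ‖(k ^ N) x‖ < ε₁ := hxW.2.resolve_left hx
      rw [ContinuousMap.mul_apply, norm_mul]
      have h2 : ‖F x‖ * ‖(k ^ N) x‖ ≤ (C + ε₂) * ε₁ :=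
        mul_le_mul (hF1 x).le h1.le (norm_nonneg _) (by positivity)
      nlinarith
    · exact hout x hxW
  · have h1 : (F * k ^ N) x = F x := by simp [hk1 x hx.2]
    rw [h1]
    linarith [hF3 x hx.1]

/-- Every weak peak set contains one on which all elements of the algebra are constant. -/
theorem IsWeakPeakSet.exists_subset_const {C : ℝ} (hC : 0 ≤ C) {P : Set X}
    (hP : IsWeakPeakSet A C P) (hPc : IsClosed P) (hPn : P.Nonempty) :
    ∃ Q ⊆ P, Q.Nonempty ∧ IsWeakPeakSet A C Q ∧ ∀ g ∈ A, ∀ x ∈ Q, ∀ y ∈ Q, g x = g y := by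
  obtain ⟨Q, hQP, hQ⟩ := zorn_superset_nonempty
    {Q : Set X | IsClosed Q ∧ Q.Nonempty ∧ IsWeakPeakSet A C Q} (fun c hc hchain hne => by
      have : Nonempty c := hne.to_subtype
      have hdir : DirectedOn (· ⊇ ·) c := fun a ha b hb =>
        (hchain.total ha hb).elim (fun h => ⟨a, ha, subset_rfl, h⟩) fun h => ⟨b, hb, h, subset_rfl⟩
      refine ⟨⋂₀ c, ⟨isClosed_sInter fun Q hQ => (hc hQ).1, ?_, ?_⟩,
        fun Q hQ => sInter_subset_of_mem hQ⟩
      · exact IsCompact.nonempty_sInter_of_directed_nonempty_isCompact_isClosed hdir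
          (fun Q hQ => (hc hQ).2.1) (fun Q hQ => (hc hQ).1.isCompact) fun Q hQ => (hc hQ).1
      · intro V hV hcV ε hε
        -- By compactness a member of the chain already lies in `V`, and its peaking functions serve
        -- the intersection, since `C` is the same for all members.
        rw [sInter_eq_iInter] at hcV
        obtain ⟨Q, hQV⟩ := exists_subset_nhds_of_isCompact' hdir.directed_val
          (fun Q => (hc Q.2).1.isCompact) (fun Q => (hc Q.2).1)
          (fun x hx => hV.mem_nhds (hcV hx))
        obtain ⟨F, hF, h1, h2, h3⟩ := (hc Q.2).2.2 V hV hQV ε hε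
        exact ⟨F, hF, h1, h2, fun x hx => h3 x (hx _ Q.2)⟩) P ⟨hPc, hPn, hP⟩
  refine ⟨Q, hQP, hQ.prop.2.1, hQ.prop.2.2, fun g hg => ?_⟩
  obtain ⟨w, hw, hwQ⟩ := hQ.prop.2.2.exists_inter_preimage hC hQ.prop.1 hQ.prop.2.1 hg
  have hsub := hQ.le_of_le (y := Q ∩ g ⁻¹' {w})
    ⟨hQ.prop.1.inter (isClosed_singleton.preimage g.continuous), hw, hwQ⟩ inter_subset_left
  intro x hx y hy
  rw [(hsub hx).2, (hsub hy).2]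

/-! ### Circles in the resolvent set and the size of the outer frontier -/

-- The zeros of `X ^ n - r ^ n` lie on the circle of radius `r`, so the inverse is a product of
-- resolvents. It serves as a discrete Riesz projection.
omit [CompactSpace X] in
theorem exists_inverse_pow_sub_pow {f : C(X, ℂ)} {r : ℝ} (hr : 0 < r)
    (h : Metric.sphere (0 : ℂ) r ⊆ resolventIn A f) {n : ℕ} (hn : 0 < n) :
    ∃ g ∈ A, ∀ x, g x * (f x ^ n - (r : ℂ) ^ n) = 1 := by
  have hζ : ∀ ζ ∈ Polynomial.nthRootsFinset n (1 : ℂ), ∃ g ∈ A, ∀ x, g x * (f x - ζ * r) = 1 := by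
    intro ζ hζ
    refine h ?_
    have h1 := (Polynomial.mem_nthRootsFinset hn 1).1 hζ
    have h2 : ‖ζ‖ = 1 := Complex.norm_eq_one_of_pow_eq_one h1 hn.ne'
    simp [h2, abs_of_pos hr]
  choose! g hg hgx using hζ
  refine ⟨∏ ζ ∈ Polynomial.nthRootsFinset n (1 : ℂ), g ζ, A.prod_mem hg, fun x => ?_⟩
  rw [(Complex.isPrimitiveRoot_exp n hn.ne').pow_sub_pow_eq_prod_sub_mul _ _ hn,
    ContinuousMap.prod_apply, ← Finset.prod_mul_distrib]
  exact Finset.prod_eq_one fun ζ hζ => hgx ζ hζ x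

/-- If the only idempotents are trivial, then no circle in the resolvent set of `f` separates the
values of `f`. -/
theorem OnlyTrivialIdempotents.not_sphere_subset (hA : IsClosed (A : Set C(X, ℂ)))
    (hid : OnlyTrivialIdempotents A) {f : C(X, ℂ)} {r : ℝ} {x₀ x₁ : X}
    (h0 : ‖f x₀‖ < r) (h1 : r < ‖f x₁‖) : ¬ Metric.sphere (0 : ℂ) r ⊆ resolventIn A f := by
  intro hS
  have hr : 0 < r := (norm_nonneg _).trans_lt h0
  obtain ⟨x₂, -, hmin⟩ := isCompact_univ.exists_isMinOn ⟨x₀, mem_univ _⟩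
    (f := fun x => |‖f x‖ - r|) (by fun_prop)
  obtain ⟨c, hc⟩ : ∃ c : ℝ, c = min |‖f x₂‖ - r| (r / 2) := ⟨_, rfl⟩
  have hc0 : 0 < c := by
    refine hc ▸ lt_min (abs_pos.2 (sub_ne_zero.2 fun h => ?_)) (half_pos hr)
    exact notMem_range_of_mem_resolventIn (hS (by simpa using h)) (mem_range_self x₂)
  have hcx : ∀ x, c ≤ |‖f x‖ - r| := fun x => hc ▸ (min_le_left _ _).trans (hmin (mem_univ x))
  have hcr : c < r := hc ▸ (min_le_right _ _).trans_lt (half_lt_self hr)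
  have hlt1 : (r - c) / r < 1 := by rw [div_lt_one hr]; linarith
  have hlt2 : r / (r + c) < 1 := by rw [div_lt_one (by positivity)]; linarith
  have e1 := (tendsto_pow_atTop_nhds_zero_of_lt_one (div_nonneg (by linarith) hr.le)
    hlt1).eventually_lt_const (show (0 : ℝ) < 1 / 5 by norm_num)
  have e2 := (tendsto_pow_atTop_nhds_zero_of_lt_one (by positivity)
    hlt2).eventually_lt_const (show (0 : ℝ) < 1 / 5 by norm_num)
  obtain ⟨n, ⟨hn1, hn2⟩, hn⟩ := ((e1.and e2).and (eventually_gt_atTop 0)).exists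
  obtain ⟨g, hg, hgx⟩ := exists_inverse_pow_sub_pow hr hS hn
  -- The function is `1 / (1 - (f / r) ^ n)`. As `|f|` stays at distance `c` from `r`, for large `n`
  -- it is near `1` inside the circle and near `0` outside.
  have hGx : ∀ x, (-(r : ℂ) ^ n • g) x * (1 - (f x / r) ^ n) = 1 := fun x => by
    have : (r : ℂ) ^ n ≠ 0 := pow_ne_zero _ (by exact_mod_cast hr.ne')
    rw [ContinuousMap.smul_apply, smul_eq_mul, div_pow]
    refine Eq.trans ?_ (hgx x)
    field_simp
    ring
  have hsmall : ∀ x, ‖f x‖ < r → ‖(-(r : ℂ) ^ n • g) x - 1‖ ≤ 1 / 4 := fun x hx => by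
    have h2 := hcx x
    rw [abs_of_neg (by linarith)] at h2
    have h3 : ‖(f x / r) ^ n‖ < 1 / 5 := by
      rw [norm_pow, norm_div, Complex.norm_of_nonneg hr.le]
      refine lt_of_le_of_lt ?_ hn1
      gcongr
      linarith
    have h4 := norm_sub_norm_le 1 ((f x / r) ^ n)
    rw [norm_one] at h4
    have h5 : ‖(-(r : ℂ) ^ n • g) x - 1‖ * ‖1 - (f x / r) ^ n‖ = ‖(f x / r) ^ n‖ := by
      rw [← norm_mul]
      congr 1
      linear_combination hGx x
    by_contra! h
    nlinarith
  have hlarge : ∀ x, r < ‖f x‖ → ‖(-(r : ℂ) ^ n • g) x‖ ≤ 1 / 4 := fun x hx => by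
    have h2 := hcx x
    rw [abs_of_pos (by linarith)] at h2
    have h3 : 5 < ‖(f x / r) ^ n‖ := by
      rw [div_pow] at hn2
      rw [norm_pow, norm_div, Complex.norm_of_nonneg hr.le, div_pow, lt_div_iff₀ (by positivity)]
      rw [div_lt_div_iff₀ (by positivity) (by norm_num)] at hn2
      have : (r + c) ^ n ≤ ‖f x‖ ^ n := by
        gcongr
        linarith
      linarith
    have h4 := norm_sub_norm_le ((f x / r) ^ n) 1
    rw [norm_one, norm_sub_rev] at h4
    have h5 := congrArg norm (hGx x)
    rw [norm_mul, norm_one] at h5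
    by_contra! h
    nlinarith
  have key := hid.forall_or_forall hA (A.smul_mem hg (-(r : ℂ) ^ n)) fun x => by
    rcases lt_or_ge ‖f x‖ r with hx | hx
    · exact Or.inr (hsmall x hx)
    · refine Or.inl (hlarge x (lt_of_le_of_ne hx fun h => ?_))
      have := hcx x
      rw [← h, sub_self, abs_zero] at this
      linarith
  have hdisj : ∀ z : ℂ, ‖z‖ ≤ 1 / 4 → ‖z - 1‖ ≤ 1 / 4 → False := fun z ha hb => by
    have := norm_sub_norm_le 1 z
    rw [norm_sub_rev, norm_one] at this
    linarith
  rcases key with h | h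
  · exact hdisj _ (h x₀) (hsmall x₀ h0)
  · exact hdisj _ (hlarge x₁ h1) (h x₁)

/-- A countable set misses some circle of radius between `ρ` and `‖f‖` and some ray. A circle inside
`Ω` would separate values of `f`; a circle disjoint from `Ω` is impossible, since the ray leads from
it into `Ω` without meeting the frontier. -/
theorem OnlyTrivialIdempotents.not_countable_frontier (hA : IsClosed (A : Set C(X, ℂ)))
    (hid : OnlyTrivialIdempotents A) {f : C(X, ℂ)} {Ω : Set ℂ} (hΩA : Ω ⊆ resolventIn A f)
    (hΩf : ∀ l : ℂ, ‖f‖ < ‖l‖ → l ∈ Ω) {ρ : ℝ} {x₀ : X} (h0 : ‖f x₀‖ ≤ ρ) (h1 : ρ < ‖f‖) :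
    ¬ (frontier Ω ∩ {z | ρ < ‖z‖}).Countable := by
  intro hQ
  have hρ : 0 ≤ ρ := (norm_nonneg _).trans h0
  obtain ⟨r, ⟨hr1, hr2⟩, hr⟩ : ∃ r ∈ Ioo ρ ‖f‖, r ∉ norm '' (frontier Ω ∩ {z | ρ < ‖z‖}) := by
    by_contra! h
    exact Cardinal.Real.Ioo_countable_iff.not.2 (not_le.2 h1) ((hQ.image _).mono h)
  have hr0 : 0 < r := hρ.trans_lt hr1
  have hdis : ∀ z ∈ Metric.sphere (0 : ℂ) r, z ∉ frontier Ω := fun z hz hzf => by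
    rw [mem_sphere_zero_iff_norm] at hz
    exact hr ⟨z, ⟨hzf, by simpa [hz] using hr1⟩, hz⟩
  have hconn : IsPreconnected (Metric.sphere (0 : ℂ) r) :=
    isPreconnected_sphere (by simp [Complex.rank_real_complex]) _ _
  by_cases hS : Metric.sphere (0 : ℂ) r ⊆ Ω
  · obtain ⟨x₁, hx₁⟩ : ∃ x, r < ‖f x‖ := by
      by_contra! h
      exact absurd ((ContinuousMap.norm_le _ hr0.le).2 h) (not_le.2 hr2)
    exact hid.not_sphere_subset hA (h0.trans_lt hr1) hx₁ (hS.trans hΩA)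
  · obtain ⟨z, hz, hzΩ⟩ := not_subset.1 hS
    have hout : ∀ w ∈ Metric.sphere (0 : ℂ) r, w ∉ Ω := fun w hw hwΩ => by
      obtain ⟨v, hv, hvf⟩ := hconn.inter_frontier_nonempty_of_mem hw hwΩ hz hzΩ
      exact hdis v hv hvf
    obtain ⟨θ, ⟨hθ0, hθ1⟩, hθ⟩ : ∃ θ ∈ Ioo (0 : ℝ) 1,
        θ ∉ Complex.arg '' (frontier Ω ∩ {z | ρ < ‖z‖}) := by
      by_contra! h
      exact Cardinal.Real.Ioo_countable_iff.not.2 (not_le.2 one_pos) ((hQ.image _).mono h)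
    obtain ⟨ray, hray⟩ : ∃ ray : ℝ → ℂ, ray = fun s : ℝ => (s : ℂ) * (Complex.cos θ +
      Complex.sin θ * Complex.I) := ⟨_, rfl⟩
    have hnorm : ∀ s, 0 ≤ s → ‖ray s‖ = s := fun s hs => by
      rw [hray, norm_mul, Complex.norm_of_nonneg hs, Complex.norm_cos_add_sin_mul_I, mul_one]
    have hf1 : r ≤ ‖f‖ + 1 := by linarith
    have hrayc : Continuous ray := by
      rw [hray]
      fun_prop
    obtain ⟨_, ⟨s, hs, rfl⟩, hsf⟩ :=
      (isPreconnected_Ici.image ray hrayc.continuousOn).inter_frontier_nonempty_of_mem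
      (mem_image_of_mem ray hf1) (hΩf _ (by rw [hnorm _ (by positivity)]; linarith))
      (mem_image_of_mem ray (mem_Ici.2 le_rfl)) (hout _ (by simpa using hnorm r hr0.le))
    have hs0 : 0 < s := hr0.trans_le hs
    refine hθ ⟨ray s, ⟨hsf, ?_⟩, ?_⟩
    · simpa [hnorm s hs0.le] using hr1.trans_le hs
    · rw [hray]
      exact Complex.arg_mul_cos_add_sin_mul_I hs0 ⟨by linarith [Real.pi_pos],
        by linarith [Real.pi_gt_three]⟩

end ClosedSubalgebra

/-! ### Countably generated subalgebras and the fibres of joint evaluation -/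

section GeneratedSubalgebra

variable {X : Type*} [TopologicalSpace X] [CompactSpace X]

theorem isSeparable_topologicalClosure_adjoin {S : Set C(X, ℂ)} (hS : S.Countable) :
    TopologicalSpace.IsSeparable ((Algebra.adjoin ℂ S).topologicalClosure : Set C(X, ℂ)) := by
  have : Countable S := hS.to_subtype
  have hcl : ((Submonoid.closure S : Submonoid C(X, ℂ)) : Set C(X, ℂ)).Countable := by
    rw [Submonoid.closure_eq_mrange, MonoidHom.coe_mrange]
    have : Countable (FreeMonoid S) := inferInstanceAs (Countable (List S))
    exact countable_range _
  rw [Subalgebra.topologicalClosure_coe]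
  refine TopologicalSpace.IsSeparable.closure ?_
  have := hcl.isSeparable.span (R := ℂ)
  rwa [← Algebra.adjoin_eq_span] at this

/-- The joint evaluation of the functions in `S`. -/
noncomputable def evalOn (S : Set C(X, ℂ)) (x : X) : S → ℂ := fun g => g.1 x

omit [CompactSpace X] in
theorem continuous_evalOn (S : Set C(X, ℂ)) : Continuous (evalOn S) :=
  continuous_pi fun g => g.1.continuous

theorem apply_eq_of_evalOn_eq {S : Set C(X, ℂ)} {x y : X} (hxy : evalOn S x = evalOn S y)
    {F : C(X, ℂ)} (hF : F ∈ (Algebra.adjoin ℂ S).topologicalClosure) : F x = F y := by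
  let B : Subalgebra ℂ C(X, ℂ) :=
    AlgHom.equalizer (ContinuousMap.evalAlgHom ℂ ℂ x) (ContinuousMap.evalAlgHom ℂ ℂ y)
  have hB : IsClosed (B : Set C(X, ℂ)) :=
    isClosed_eq (f := fun F : C(X, ℂ) => F x) (g := fun F : C(X, ℂ) => F y)
      (continuous_eval_const x) (continuous_eval_const y)
  have hle : (Algebra.adjoin ℂ S).topologicalClosure ≤ B :=
    Subalgebra.topologicalClosure_minimal (Algebra.adjoin_le fun g hg => congrFun hxy ⟨g, hg⟩) hB
  exact hle hF

/-- The set of fibres of a map to a second countable space which are weak peak sets is Borel. -/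
theorem measurableSet_isWeakPeakSet_fiber {Y : Type*} [TopologicalSpace Y] [T2Space Y]
    [SecondCountableTopology Y] [MeasurableSpace Y] [BorelSpace Y] {Φ : X → Y} (hΦ : Continuous Φ)
    (A : Subalgebra ℂ C(X, ℂ)) (C : ℝ) :
    MeasurableSet {m | IsWeakPeakSet A C (Φ ⁻¹' {m})} := by
  -- Near a fibre that peaks relative to the basic set `b` with tolerance `1 / (k + 1)`, one `F`
  -- serves all neighbouring fibres, because `Φ` is a closed map. Countably many pairs `b, k`
  -- suffice.
  let O : Set Y → ℕ → Set Y := fun b k => ⋃₀ {N | IsOpen N ∧ ∃ F ∈ A,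
    (∀ x, ‖F x‖ < C + 1 / ((k : ℝ) + 1)) ∧ (∀ x, Φ x ∉ b → ‖F x‖ < 1 / ((k : ℝ) + 1)) ∧
    ∀ x, Φ x ∈ N → ‖F x - 1‖ < 1 / ((k : ℝ) + 1)}
  have hO : ∀ b k, IsOpen (O b k) := fun b k => isOpen_sUnion fun N hN => hN.1
  have heq : {m | IsWeakPeakSet A C (Φ ⁻¹' {m})} =
      ⋂ b ∈ TopologicalSpace.countableBasis Y, ⋂ k : ℕ, (bᶜ ∪ O b k) := by
    ext m
    simp only [mem_ofPred_eq, mem_iInter]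
    constructor
    · intro h b hb k
      by_cases hm : m ∈ b
      · right
        have hk : 0 < 1 / ((k : ℝ) + 1) := by positivity
        obtain ⟨F, hF, h1, h2, h3⟩ := h (Φ ⁻¹' b)
          ((TopologicalSpace.isOpen_of_mem_countableBasis hb).preimage hΦ)
          (fun x hx => by simpa [mem_singleton_iff.1 hx] using hm) _ hk
        have hcl : IsClosed (Φ '' {x | 1 / ((k : ℝ) + 1) ≤ ‖F x - 1‖}) :=
          ((isClosed_le continuous_const (by fun_prop)).isCompact.image hΦ).isClosed
        refine ⟨_, ⟨hcl.isOpen_compl, F, hF, h1, h2, fun x hx => ?_⟩, ?_⟩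
        · by_contra! hge
          exact hx ⟨x, hge, rfl⟩
        · rintro ⟨x, hx, rfl⟩
          exact absurd (h3 x rfl) (not_lt.2 hx)
      · exact Or.inl hm
    · intro h V hV hmV ε hε
      have hcl : IsClosed (Φ '' Vᶜ) := (hV.isClosed_compl.isCompact.image hΦ).isClosed
      obtain ⟨b, hb, hmb, hbV⟩ :=
        (TopologicalSpace.isBasis_countableBasis Y).exists_subset_of_mem_open
        (show m ∈ (Φ '' Vᶜ)ᶜ by
          rintro ⟨x, hx, rfl⟩
          exact hx (hmV rfl)) hcl.isOpen_compl
      obtain ⟨k, hk⟩ := exists_nat_one_div_lt hε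
      rcases h b hb k with hm | ⟨N, ⟨-, F, hF, h1, h2, h3⟩, hmN⟩
      · exact absurd hmb hm
      · refine ⟨F, hF, fun x => (h1 x).trans (by linarith), fun x hx => (h2 x fun hxb => ?_).trans hk,
          fun x hx => (h3 x ?_).trans hk⟩
        · exact hbV hxb ⟨x, hx, rfl⟩
        · rw [show Φ x = m from hx]
          exact hmN
  rw [heq]
  exact MeasurableSet.biInter (TopologicalSpace.countable_countableBasis Y) fun b hb =>
    MeasurableSet.iInter fun k =>
      (TopologicalSpace.isOpen_of_mem_countableBasis hb).measurableSet.compl.union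
        (hO b k).measurableSet

/-- A weak peak set on which all elements of the algebra generated by `S` are constant is a fibre
of the joint evaluation map. -/
theorem IsWeakPeakSet.eq_fiber [T2Space X] {S : Set C(X, ℂ)} {C : ℝ} {Q : Set X}
    (hQ : IsWeakPeakSet (Algebra.adjoin ℂ S).topologicalClosure C Q)
    (hconst : ∀ g ∈ (Algebra.adjoin ℂ S).topologicalClosure, ∀ x ∈ Q, ∀ y ∈ Q, g x = g y)
    {q : X} (hq : q ∈ Q) : Q = evalOn S ⁻¹' {evalOn S q} := by
  refine subset_antisymm (fun x hx => ?_) fun x hx => ?_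
  · funext g
    exact hconst g.1 (Subalgebra.le_topologicalClosure _ (Algebra.subset_adjoin g.2)) x hx q hq
  · by_contra hxQ
    obtain ⟨F, hF, -, h2, h3⟩ := hQ {x}ᶜ isOpen_compl_singleton
      (fun y hy h => hxQ ((show y = x from h) ▸ hy)) (1 / 2) (by norm_num)
    have h4 := h2 x (by simp)
    have h5 := h3 q hq
    rw [← apply_eq_of_evalOn_eq hx hF] at h5
    have h6 := norm_sub_norm_le 1 (F x)
    rw [norm_sub_rev, norm_one] at h6
    linarith

end GeneratedSubalgebra

/-! ### A Cantor set from singleton fibres -/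

/-- An uncountable Borel set of singleton fibres of a map defined on a compact space yields a
Cantor set. -/
theorem containsCantorSubset_of_subsingleton_fibers {X Y L : Type*} [TopologicalSpace X]
    [CompactSpace X] [TopologicalSpace L] [T2Space L] [TopologicalSpace Y] [PolishSpace Y]
    [MeasurableSpace Y] [BorelSpace Y] {Φ : X → Y} (hΦ : Continuous Φ) {E : Set Y}
    (hE : MeasurableSet E) (hEc : ¬ E.Countable) (hEr : E ⊆ range Φ)
    (hEs : ∀ m ∈ E, (Φ ⁻¹' {m}).Subsingleton) {W : Set X} (hW : Φ ⁻¹' E ⊆ W) {ψ : W → L}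
    (hψ : Continuous ψ) (hψi : Function.Injective ψ) : ContainsCantorSubset L := by
  obtain ⟨c, hcE, hcc, hci⟩ : ∃ c : (ℕ → Bool) → Y, range c ⊆ E ∧ Continuous c ∧
      Function.Injective c := by
    -- In a finer Polish topology `E` is closed, hence contains a Cantor set; the parametrisation
    -- stays continuous for the original topology.
    obtain ⟨T, hT, hTp, hTc, -⟩ := hE.isClopenable
    obtain ⟨c, h1, h2, h3⟩ := @IsClosed.exists_nat_bool_injection_of_not_countable Y T hTp E hTc hEc
    exact ⟨c, h1, continuous_le_rng hT h2, h3⟩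
  have hemb : IsClosedEmbedding c := hcc.isClosedEmbedding hci
  have hKc : IsClosed (Φ ⁻¹' range c) := hemb.isClosed_range.preimage hΦ
  have : CompactSpace (Φ ⁻¹' range c) := isCompact_iff_compactSpace.1 hKc.isCompact
  choose κ hκ using fun x : Φ ⁻¹' range c => x.2
  have hκc : Continuous κ := by
    rw [hemb.isInducing.continuous_iff]
    have : c ∘ κ = fun x : Φ ⁻¹' range c => Φ x := funext hκ
    rw [this]
    exact hΦ.comp continuous_subtype_val
  have hκb : Function.Bijective κ := by
    refine ⟨fun x y hxy => Subtype.ext ?_, fun t => ?_⟩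
    · refine hEs (c (κ x)) (hcE (mem_range_self _)) (hκ x).symm ?_
      rw [hxy]
      exact (hκ y).symm
    · obtain ⟨x, hx⟩ := hEr (hcE (mem_range_self t))
      refine ⟨⟨x, t, hx.symm⟩, hci ?_⟩
      rw [hκ, hx]
  let e : (Φ ⁻¹' range c) ≃ₜ (ℕ → Bool) :=
    hκc.homeoOfEquivCompactToT2 (f := Equiv.ofBijective κ hκb)
  have hKW : ∀ x : Φ ⁻¹' range c, x.1 ∈ W := fun x => hW (hcE x.2)
  have hemb2 : IsClosedEmbedding fun t => ψ ⟨(e.symm t).1, hKW _⟩ := by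
    refine Continuous.isClosedEmbedding ?_ fun t t' h => ?_
    · exact hψ.comp ((continuous_subtype_val.comp e.symm.continuous).subtype_mk _)
    · exact e.symm.injective (Subtype.ext (Subtype.mk.inj (hψi h)))
  exact ⟨_, ⟨hemb2.toIsEmbedding.toHomeomorph.symm⟩⟩

/-! ### Gaps in a separable ordered space -/

section Order

variable {L : Type*} [LinearOrder L]

/-- A countable set has only countably many immediate neighbours. -/
theorem countable_setOf_covBy {D : Set L} (hD : D.Countable) :
    {b | ∃ d ∈ D, d ⋖ b ∨ b ⋖ d}.Countable := by
  have : {b | ∃ d ∈ D, d ⋖ b ∨ b ⋖ d} = ⋃ d ∈ D, ({b | d ⋖ b} ∪ {b | b ⋖ d}) := by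
    ext
    simp
  rw [this]
  refine hD.biUnion fun d _ => Countable.union ?_ ?_
  · exact Set.Subsingleton.countable fun a ha b hb => CovBy.unique_right ha hb
  · exact Set.Subsingleton.countable fun a ha b hb => CovBy.unique_left ha hb

variable [TopologicalSpace L] [OrderTopology L] {D : Set L}

/-- Between a point of `D` in `[a, b]` and a different endpoint there is either another point of
`D`, or nothing, and then that endpoint is an immediate neighbour. Both cases give a forbidden pair.
-/
theorem Dense.disjoint_Icc_of_neighbours (hD : Dense D) {a b : L} (hab : a < b)
    (h : ∀ d ∈ D ∪ {b | ∃ d ∈ D, d ⋖ b ∨ b ⋖ d}, ∀ d' ∈ D ∪ {b | ∃ d ∈ D, d ⋖ b ∨ b ⋖ d},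
      d < d' → a ≤ d → d' ≤ b → False) : ∀ d ∈ D, d ∉ Icc a b := by
  have hne : ∀ x y, x < y → x ⋖ y ∨ ∃ d ∈ D, d ∈ Ioo x y := fun x y hxy => by
    by_cases hc : x ⋖ y
    · exact Or.inl hc
    · obtain ⟨c, hc⟩ := (not_covBy_iff hxy).1 hc
      obtain ⟨d, hd, hdD⟩ := hD.exists_mem_open isOpen_Ioo ⟨c, hc⟩
      exact Or.inr ⟨d, hd, hdD⟩
  rintro d hd ⟨had, hdb⟩
  rcases had.eq_or_lt with rfl | had
  · rcases hne _ _ hab with hc | ⟨e, he, he1, he2⟩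
    · exact h _ (Or.inl hd) b (Or.inr ⟨_, hd, Or.inl hc⟩) hab le_rfl le_rfl
    · exact h _ (Or.inl hd) e (Or.inl he) he1 le_rfl he2.le
  · rcases hne _ _ had with hc | ⟨e, he, he1, he2⟩
    · exact h a (Or.inr ⟨_, hd, Or.inr hc⟩) _ (Or.inl hd) had le_rfl hdb
    · exact h e (Or.inl he) _ (Or.inl hd) he2 he1.le hdb

/-- Every neighbourhood of `a` below `b` meets `D`, and can do so only to the left of `a`; thus `D`
accumulates at `a` from the left. -/
theorem Dense.exists_Ioc_subset (hD : Dense D) {a b : L} (hab : a < b) (h : ∀ d ∈ D, d ∉ Icc a b)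
    {s : Set L} (hs : s ∈ 𝓝 a) : ∃ p ∈ D, p < a ∧ Ioc p a ⊆ s := by
  have key : ∀ O : Set L, IsOpen O → a ∈ O → O ⊆ Iio b → ∃ d ∈ D, d ∈ O ∧ d < a :=
    fun O hO ha hOb => by
      obtain ⟨d, hdD, hd⟩ := hD.exists_mem_open hO ⟨a, ha⟩
      refine ⟨d, hdD, hd, ?_⟩
      by_contra! hle
      exact h d hdD ⟨hle, (hOb hd).le⟩
  obtain ⟨d₀, -, -, hd₀⟩ := key (Iio b) isOpen_Iio hab subset_rfl
  obtain ⟨l, hl, hls⟩ := exists_Ioc_subset_of_mem_nhds hs ⟨d₀, hd₀⟩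
  obtain ⟨d, hdD, hd, hda⟩ := key (Ioo l b) isOpen_Ioo ⟨hl, hab⟩ Ioo_subset_Iio_self
  exact ⟨d, hdD, hda, (Ioc_subset_Ioc_left hd.1.le).trans hls⟩

theorem Dense.exists_Ico_subset (hD : Dense D) {a b : L} (hab : a < b) (h : ∀ d ∈ D, d ∉ Icc a b)
    {s : Set L} (hs : s ∈ 𝓝 b) : ∃ q ∈ D, b < q ∧ Ico b q ⊆ s := by
  obtain ⟨q, hq, hbq, hqs⟩ := Dense.exists_Ioc_subset (L := Lᵒᵈ) (D := OrderDual.ofDual ⁻¹' D)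
    (a := OrderDual.toDual b) (b := OrderDual.toDual a) hD hab (fun d hd hdm => h _ hd ⟨hdm.2, hdm.1⟩)
    (s := OrderDual.ofDual ⁻¹' s) hs
  exact ⟨OrderDual.ofDual q, hq, hbq, fun x hx => hqs (show OrderDual.toDual x ∈ _ from ⟨hx.2, hx.1⟩)⟩

end Order

/-- Countably many elements of a point-separating family separate any two points which the map `ψ`
sends to different sides of a jump between two elements of a countable set. -/
theorem exists_countable_separating_jumps {X L : Type*} [TopologicalSpace X] [CompactSpace X]
    [LinearOrder L] [TopologicalSpace L] [OrderClosedTopology L] {W : Set X} (hW : IsClosed W)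
    {ψ : W → L} (hψ : Continuous ψ) {A : Set C(X, ℂ)} (hA : ∀ x y, x ≠ y → ∃ g ∈ A, g x ≠ g y)
    {D : Set L} (hD : D.Countable) :
    ∃ S ⊆ A, S.Countable ∧ ∀ x y : W, ∀ d ∈ D, ∀ d' ∈ D, d < d' → ψ x ≤ d → d' ≤ ψ y →
      ∃ g ∈ S, g x ≠ g y := by
  have : CompactSpace W := isCompact_iff_compactSpace.1 hW.isCompact
  have hfin : ∀ d d', d < d' → ∃ t : Set C(X, ℂ), t ⊆ A ∧ t.Countable ∧
      ∀ x y : W, ψ x ≤ d → d' ≤ ψ y → ∃ g ∈ t, g x ≠ g y := by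
    intro d d' hdd'
    -- The pairs lying on opposite sides of one jump form a compact set off the diagonal, so
    -- finitely many functions separate all of them.
    have hK : IsCompact {p : W × W | ψ p.1 ≤ d ∧ d' ≤ ψ p.2} :=
      ((isClosed_le (by fun_prop) continuous_const).inter
        (isClosed_le continuous_const (by fun_prop))).isCompact
    obtain ⟨t, ht⟩ := hK.elim_finite_subcover (fun g : A => {p : W × W | g.1 p.1 ≠ g.1 p.2})
      (fun g => isOpen_ne_fun (by fun_prop) (by fun_prop)) fun p hp => by
        obtain ⟨g, hg, hne⟩ := hA p.1.1 p.2.1 fun h => by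
          have h1 := hp.1.trans_lt (hdd'.trans_le hp.2)
          rw [Subtype.ext h] at h1
          exact lt_irrefl _ h1
        exact mem_iUnion.2 ⟨⟨g, hg⟩, hne⟩
    refine ⟨Subtype.val '' (t : Set A), Subtype.coe_image_subset _ _, (t.countable_toSet).image _,
      fun x y hx hy => ?_⟩
    obtain ⟨g, hg, hne⟩ := mem_iUnion₂.1 (ht (show (x, y) ∈ _ from ⟨hx, hy⟩))
    exact ⟨g.1, ⟨g, hg, rfl⟩, hne⟩
  choose! t htA htc ht using hfin
  refine ⟨⋃ d ∈ D, ⋃ d' ∈ {d' ∈ D | d < d'}, t d d', ?_, ?_, ?_⟩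
  · exact iUnion₂_subset fun d _ => iUnion₂_subset fun d' hd' => htA d d' hd'.2
  · exact hD.biUnion fun d _ => (hD.mono (sep_subset _ _)).biUnion fun d' hd' => htc d d' hd'.2
  · intro x y d hd d' hd' hlt hx hy
    obtain ⟨g, hg, hne⟩ := ht d d' hlt x y hx hy
    exact ⟨g, mem_iUnion₂.2 ⟨d, hd, mem_iUnion₂.2 ⟨d', ⟨hd', hlt⟩, hg⟩⟩, hne⟩

/-! ### Localised steps at gaps and the resulting idempotent -/

section Cut

variable {X L : Type*} [TopologicalSpace X] [CompactSpace X] [LinearOrder L]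

/-- The pair `a, b` of points of `W` is a jump for `h`, localised by `F` to an interval. -/
structure IsCut {W : Set X} (ψ : W → L) (U : Set X) (a b : W) (p q p' q' : L) (h F : C(X, ℂ)) :
    Prop where
  left_mem : b.1 ∈ U
  lt : ψ a < ψ b
  gap : ∀ c, c ≤ ψ a ∨ ψ b ≤ c
  lower : p < ψ a
  upper : ψ b < q
  lower' : p' < ψ a
  upper' : ψ b < q'
  small_left : ∀ x : W, p < ψ x → ψ x ≤ ψ a → ‖h x‖ ≤ 1 / 1000
  near_right : ∀ x : W, ψ b ≤ ψ x → ψ x < q → ‖h x - 1‖ ≤ 1 / 1000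
  bounded : ∀ x, ‖F x‖ ≤ 41
  -- The hypothesis says that `x` is not a point of `U` with `ψ`-value in `(p, q)`. The interval
  -- `(p', q')` is separate because `F` is constructed only after `(p, q)`.
  small_out : ∀ x, (∀ hx : x ∈ W, x ∈ U → p < ψ ⟨x, hx⟩ → ψ ⟨x, hx⟩ < q → False) →
    ‖F x * h x‖ ≤ 1 / 1000
  near_one : ∀ x : W, p' < ψ x → ψ x < q' → ‖F x - 1‖ ≤ 1 / 1000

/-- Consider `F * h - F₁ * h₁` on points of `U` with `ψ`-value in `(p, q)`. Up to `a` both `h` and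
`h₁` are small; from `b₁` on both are near `1` and `F` is close to `F₁`; from `b` to `a₁` only `F *
h` survives, and it is near `1`. Elsewhere both products are small. The value is near `1` at `b` and
near `0` outside `U`. -/
theorem IsCut.false_of_lt {A : Subalgebra ℂ C(X, ℂ)} (hA : IsClosed (A : Set C(X, ℂ)))
    (hid : OnlyTrivialIdempotents A) {U W : Set X} (hU : U ≠ univ) {ψ : W → L}
    {p q p' q' : L} {a b a₁ b₁ : W} {h F h₁ F₁ : C(X, ℂ)}
    (H : IsCut ψ U a b p q p' q' h F) (H₁ : IsCut ψ U a₁ b₁ p q p' q' h₁ F₁)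
    (hh : h ∈ A) (hF : F ∈ A) (hh₁ : h₁ ∈ A) (hF₁ : F₁ ∈ A)
    (hFF : ‖F - F₁‖ ≤ 1 / 500) (hlt : ψ a < ψ a₁) : False := by
  have hba : ψ b ≤ ψ a₁ := (H.gap (ψ a₁)).resolve_left (not_le.2 hlt)
  have hout : ∀ x, (∀ hx : x ∈ W, x ∈ U → p < ψ ⟨x, hx⟩ → ψ ⟨x, hx⟩ < q → False) →
      ‖(F * h - F₁ * h₁) x‖ ≤ 1 / 4 := fun x hx => by
    have h1 := norm_sub_le (F x * h x) (F₁ x * h₁ x)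
    have h2 := H.small_out x hx
    have h3 := H₁.small_out x hx
    simp only [ContinuousMap.sub_apply, ContinuousMap.mul_apply]
    linarith
  have hmul : ∀ u v : ℂ, ‖u‖ ≤ 41 → ‖v‖ ≤ 1 / 1000 → ‖u * v‖ ≤ 41 / 1000 := fun u v hu hv => by
    rw [norm_mul]
    calc ‖u‖ * ‖v‖ ≤ 41 * (1 / 1000) := by gcongr
      _ = 41 / 1000 := by norm_num
  have hmid : ∀ x : W, x.1 ∈ U → ψ b ≤ ψ x → ψ x ≤ ψ a₁ → ‖(F * h - F₁ * h₁) x - 1‖ ≤ 1 / 4 :=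
    fun x hxU hx hx' => by
      have h1 := hmul _ _ (H.bounded x) (H.near_right x hx (hx'.trans_lt (H₁.lt.trans H₁.upper)))
      have h2 := H.near_one x (H.lower'.trans (H.lt.trans_le hx))
        (hx'.trans_lt (H₁.lt.trans H₁.upper'))
      have h3 := hmul _ _ (H₁.bounded x) (H₁.small_left x (H.lower.trans (H.lt.trans_le hx)) hx')
      have h4 : (F * h - F₁ * h₁) x - 1 =
          F x * (h x - 1) + (F x - 1) - F₁ x * h₁ x := by
        simp only [ContinuousMap.sub_apply, ContinuousMap.mul_apply]
        ring
      rw [h4]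
      have h5 := norm_sub_le (F x * (h x - 1) + (F x - 1)) (F₁ x * h₁ x)
      have h6 := norm_add_le (F x * (h x - 1)) (F x - 1)
      linarith
  have hin : ∀ x : W, x.1 ∈ U → p < ψ x → ψ x < q → ‖(F * h - F₁ * h₁) x‖ ≤ 1 / 4 ∨
      ‖(F * h - F₁ * h₁) x - 1‖ ≤ 1 / 4 := fun x hxU hpx hxq => by
    rcases H.gap (ψ x) with hx | hx
    · left
      have h1 := hmul _ _ (H.bounded x) (H.small_left x hpx hx)
      have h2 := hmul _ _ (H₁.bounded x) (H₁.small_left x hpx (hx.trans hlt.le))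
      have h3 := norm_sub_le (F x * h x) (F₁ x * h₁ x)
      simp only [ContinuousMap.sub_apply, ContinuousMap.mul_apply]
      linarith
    · rcases H₁.gap (ψ x) with hx' | hx'
      · exact Or.inr (hmid x hxU hx hx')
      · left
        have h1 := hmul _ _ (H.bounded x) (H.near_right x hx hxq)
        have h2 := hmul _ _ (H₁.bounded x) (H₁.near_right x hx' hxq)
        have h3 := ((F - F₁).norm_coe_le_norm x).trans hFF
        have h4 : (F * h - F₁ * h₁) x =
            F x * (h x - 1) - F₁ x * (h₁ x - 1) + (F - F₁) x := by
          simp only [ContinuousMap.sub_apply, ContinuousMap.mul_apply]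
          ring
        rw [h4]
        have h5 := norm_add_le (F x * (h x - 1) - F₁ x * (h₁ x - 1)) ((F - F₁) x)
        have h6 := norm_sub_le (F x * (h x - 1)) (F₁ x * (h₁ x - 1))
        linarith
  have key := hid.forall_or_forall hA (A.sub_mem (A.mul_mem hF hh) (A.mul_mem hF₁ hh₁)) fun x => by
    by_cases hx : ∀ hx : x ∈ W, x ∈ U → p < ψ ⟨x, hx⟩ → ψ ⟨x, hx⟩ < q → False
    · exact Or.inl (hout x hx)
    · push Not at hx
      obtain ⟨hxW, hxU, hpx, hxq⟩ := hx
      exact hin ⟨x, hxW⟩ hxU hpx hxq.1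
  have hdisj : ∀ z : ℂ, ‖z‖ ≤ 1 / 4 → ‖z - 1‖ ≤ 1 / 4 → False := fun z ha hb => by
    have := norm_sub_norm_le 1 z
    rw [norm_sub_rev, norm_one] at this
    linarith
  obtain ⟨x₀, hx₀⟩ := (ne_univ_iff_exists_notMem U).1 hU
  rcases key with h | h
  · exact hdisj _ (h b) (hmid b H.left_mem le_rfl hba)
  · exact hdisj _ (hout x₀ fun _ hx => absurd hx hx₀) (h x₀)

end Cut

section Cut

variable {X L : Type*} [TopologicalSpace X] [CompactSpace X] [LinearOrder L] [TopologicalSpace L]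
  [OrderTopology L]

/-- The step `h` comes from `A`, because in the application the functions in `B` do not distinguish
`a` from `b`. The weak peak property supplies only the cut-off `F`, with tolerance divided by `‖h‖ +
1` so that `F * h` is small outside. -/
theorem exists_isCut {A B : Subalgebra ℂ C(X, ℂ)} (hA : A.SeparatesPoints) {U W : Set X}
    (hU : IsOpen U) (hUW : U ⊆ W) {ψ : W → L} (hψ : IsEmbedding ψ) {D : Set L} (hD : Dense D)
    {T : Set X} (hT : IsWeakPeakSet B 40 T) {a b : W} (hTab : T = {a.1, b.1}) (haU : a.1 ∈ U)
    (hbU : b.1 ∈ U) (hab : ψ a < ψ b) (hDab : ∀ d ∈ D, d ∉ Icc (ψ a) (ψ b)) :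
    ∃ p ∈ D, ∃ q ∈ D, ∃ p' ∈ D, ∃ q' ∈ D, ∃ h ∈ A, ∃ F ∈ B, IsCut ψ U a b p q p' q' h F := by
  have hgap : ∀ c, c ≤ ψ a ∨ ψ b ≤ c := fun c => by
    by_contra! hc
    obtain ⟨d, hd, hdo⟩ := hD.exists_mem_open isOpen_Ioo ⟨c, hc⟩
    exact hDab d hd (Ioo_subset_Icc_self hdo)
  have hne : a.1 ≠ b.1 := fun h => by
    rw [Subtype.ext h] at hab
    exact lt_irrefl _ hab
  obtain ⟨_, ⟨g, hg, rfl⟩, hgne⟩ := hA hne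
  have hg0 : g b - g a ≠ 0 := sub_ne_zero.2 (Ne.symm hgne)
  obtain ⟨h, hh⟩ : ∃ h : C(X, ℂ), h = (g b - g a)⁻¹ • (g - algebraMap ℂ _ (g a)) := ⟨_, rfl⟩
  have hhA : h ∈ A := hh ▸ A.smul_mem (A.sub_mem hg (A.algebraMap_mem _)) _
  have hha : h a = 0 := by simp [hh]
  have hhb : h b = 1 := by simp [hh, hg0]
  have hnhds : ∀ (c : W) (s : Set W), s ∈ 𝓝 c → ∃ t ∈ 𝓝 (ψ c), ψ ⁻¹' t ⊆ s := fun c s hs => by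
    rwa [hψ.nhds_eq_comap, mem_comap] at hs
  have hnear : ∀ (k : C(X, ℂ)) (c : W), k c = 0 → ∃ t ∈ 𝓝 (ψ c), ∀ x : W, ψ x ∈ t →
      ‖k x‖ ≤ 1 / 1000 := fun k c hk => by
    obtain ⟨t, ht, hts⟩ := hnhds c {x : W | ‖k x‖ < 1 / 1000}
      ((isOpen_lt (by fun_prop) continuous_const).mem_nhds (by
        simp only [mem_ofPred_eq, hk, norm_zero]
        norm_num))
    exact ⟨t, ht, fun x hx => (show ‖k x‖ < 1 / 1000 from hts hx).le⟩
  have hnear' : ∀ (k : C(X, ℂ)) (c : W), ‖k c - 1‖ < 1 / 1000 → ∃ t ∈ 𝓝 (ψ c), ∀ x : W, ψ x ∈ t →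
      ‖k x - 1‖ ≤ 1 / 1000 := fun k c hk => by
    obtain ⟨t, ht, hts⟩ := hnhds c {x : W | ‖k x - 1‖ < 1 / 1000}
      ((isOpen_lt (by fun_prop) continuous_const).mem_nhds hk)
    exact ⟨t, ht, fun x hx => (show ‖k x - 1‖ < 1 / 1000 from hts hx).le⟩
  obtain ⟨s, hs, hsx⟩ := hnear h a hha
  obtain ⟨t, ht, htx⟩ := hnear' h b (by simp [hhb])
  obtain ⟨p, hpD, hpa, hps⟩ := hD.exists_Ioc_subset hab hDab hs
  obtain ⟨q, hqD, hbq, hqt⟩ := hD.exists_Ico_subset hab hDab ht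
  obtain ⟨O, hO, hOψ⟩ := isOpen_induced_iff.1 ((isOpen_Ioo (a := p) (b := q)).preimage hψ.continuous)
  have hOx : ∀ x : W, x.1 ∈ O ↔ p < ψ x ∧ ψ x < q := fun x => by
    change x ∈ Subtype.val ⁻¹' O ↔ _
    rw [hOψ]
    rfl
  have hε : 0 < 1 / (1000 * (‖h‖ + 1)) := by positivity
  have hε1 : 1 / (1000 * (‖h‖ + 1)) ≤ 1 / 1000 := by
    gcongr
    linarith [norm_nonneg h]
  obtain ⟨F, hF, hF1, hF2, hF3⟩ := hT (U ∩ O) (hU.inter hO) (by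
    rw [hTab]
    rintro x (rfl | rfl)
    · exact ⟨haU, (hOx a).2 ⟨hpa, hab.trans hbq⟩⟩
    · exact ⟨hbU, (hOx b).2 ⟨hpa.trans hab, hbq⟩⟩) _ hε
  obtain ⟨s', hs', hsx'⟩ := hnear' F a ((hF3 a (by simp [hTab])).trans_le hε1)
  obtain ⟨t', ht', htx'⟩ := hnear' F b ((hF3 b (by simp [hTab])).trans_le hε1)
  obtain ⟨p', hpD', hpa', hps'⟩ := hD.exists_Ioc_subset hab hDab hs'
  obtain ⟨q', hqD', hbq', hqt'⟩ := hD.exists_Ico_subset hab hDab ht'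
  refine ⟨p, hpD, q, hqD, p', hpD', q', hqD', h, hhA, F, hF,
    { left_mem := hbU, lt := hab, gap := hgap, lower := hpa, upper := hbq, lower' := hpa',
      upper' := hbq', small_left := fun x h1 h2 => hsx x (hps ⟨h1, h2⟩),
      near_right := fun x h1 h2 => htx x (hqt ⟨h1, h2⟩),
      bounded := fun x => by linarith [hF1 x], small_out := fun x hx => ?_,
      near_one := fun x h1 h2 => ?_ }⟩
  · have hxV : x ∉ U ∩ O := by
      rintro ⟨hxU, hxO⟩
      have h1 := (hOx ⟨x, hUW hxU⟩).1 hxO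
      exact hx (hUW hxU) hxU h1.1 h1.2
    have h1 := (hF2 x hxV).le
    rw [norm_mul]
    calc ‖F x‖ * ‖h x‖ ≤ 1 / (1000 * (‖h‖ + 1)) * (‖h‖ + 1) := by
          gcongr
          linarith [h.norm_coe_le_norm x]
      _ = 1 / 1000 := by
          field_simp
  · rcases hgap (ψ x) with h3 | h3
    · exact hsx' x (hps' ⟨h1, h3⟩)
    · exact htx' x (hqt' ⟨h3, h2⟩)

omit [TopologicalSpace L] [OrderTopology L] in
/-- Uncountably many pairs at which the algebra has cuts produce a nontrivial idempotent. -/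
theorem false_of_uncountable_cuts {A B : Subalgebra ℂ C(X, ℂ)} (hA : IsClosed (A : Set C(X, ℂ)))
    (hid : OnlyTrivialIdempotents A) (hBA : B ≤ A)
    (hB : TopologicalSpace.IsSeparable (B : Set C(X, ℂ))) {U W : Set X} (hU : U ≠ univ) {ψ : W → L} (hψ : Function.Injective ψ) {D : Set L} (hD : D.Countable)
    {I : Type*} [Uncountable I] {a b : I → W} (ha : Function.Injective a)
    (hcut : ∀ i, ∃ p ∈ D, ∃ q ∈ D, ∃ p' ∈ D, ∃ q' ∈ D, ∃ h ∈ A, ∃ F ∈ B,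
      IsCut ψ U (a i) (b i) p q p' q' h F) : False := by
  choose p hp q hq p' hp' q' hq' h hh F hF H using hcut
  obtain ⟨c, hc, hBc⟩ := hB
  have : Countable D := hD.to_subtype
  have : Countable c := hc.to_subtype
  have happ : ∀ i, ∃ k : c, dist (F i) k.1 < 1 / 1000 := fun i => by
    obtain ⟨k, hk, hki⟩ := Metric.mem_closure_iff.1 (hBc (hF i)) (1 / 1000) (by norm_num)
    exact ⟨⟨k, hk⟩, hki⟩
  choose k hk using happ
  -- Only the endpoints and an approximation of `F` within `1 / 1000` are recorded. The functions
  -- `h` are not, since `A` need not be separable and `IsCut.false_of_lt` does not compare them.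
  let data : I → D × D × D × D × c := fun i =>
    (⟨p i, hp i⟩, ⟨q i, hq i⟩, ⟨p' i, hp' i⟩, ⟨q' i, hq' i⟩, k i)
  obtain ⟨i, j, hij, hdata⟩ : ∃ i j, i ≠ j ∧ data i = data j := by
    by_contra! hinj
    have : Function.Injective data := fun i j hij => by
      by_contra hne
      exact hinj i j hne hij
    exact not_countable this.countable
  simp only [data, Prod.mk.injEq, Subtype.mk.injEq] at hdata
  obtain ⟨e1, e2, e3, e4, e5⟩ := hdata
  have hFF : ∀ i j, k i = k j → ‖F i - F j‖ ≤ 1 / 500 := fun i j e => by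
    have h1 := hk i
    have h2 := hk j
    rw [← e] at h2
    have h3 := dist_triangle_right (F i) (F j) (k i).1
    rw [← dist_eq_norm]
    linarith
  rcases lt_trichotomy (ψ (a i)) (ψ (a j)) with hlt | heq | hlt
  · have Hj := H j
    rw [← e1, ← e2, ← e3, ← e4] at Hj
    exact (H i).false_of_lt hA hid hU Hj (hh i) (hBA (hF i)) (hh j) (hBA (hF j))
      (hFF i j e5) hlt
  · exact hij (ha (hψ heq))
  · have Hi := H i
    rw [e1, e2, e3, e4] at Hi
    exact (H j).false_of_lt hA hid hU Hi (hh j) (hBA (hF j)) (hh i) (hBA (hF i))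
      (hFF j i e5.symm) hlt

end Cut

/-! ### Proof of removability -/

theorem mainTheorem4 (L : Type u) [LinearOrder L] [TopologicalSpace L] [OrderTopology L]
    [CompactSpace L] [TopologicalSpace.SeparableSpace L] (hL : ¬ ContainsCantorSubset L) :
    IsRemovable.{u, v} L := by
  intro X _ _ _ U A hUo hUne ⟨Z, ⟨e⟩⟩ hAc hid
  by_contra hsub
  obtain ⟨x₀, hx₀⟩ := (ne_univ_iff_exists_notMem U).1 hUne
  have : Nonempty X := ⟨x₀⟩
  have hnb : ¬ IsBoundaryFor A Uᶜ := fun h => hsub (sInter_subset_of_mem h)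
  rw [isBoundaryFor_iff, not_and] at hnb
  have := hnb hUo.isClosed_compl
  push Not at this
  obtain ⟨f, hfA, hf1, hf2⟩ := this
  obtain ⟨x₁, hx₁, hmax⟩ := hUo.isClosed_compl.isCompact.exists_isMaxOn ⟨x₀, hx₀⟩
    (f := fun x => ‖f x‖) (by fun_prop)
  have hρ : ∀ x ∉ U, ‖f x‖ ≤ ‖f x₁‖ := fun x hx => hmax hx
  let ψ : closure U → L := fun x => (e x).1
  have hψ : IsEmbedding ψ := IsEmbedding.subtypeVal.comp e.isEmbedding
  obtain ⟨D, hDc, hDd⟩ := TopologicalSpace.exists_countable_dense L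
  -- Immediate neighbours of points of `D` are included so that `Dense.disjoint_Icc_of_neighbours`
  -- applies to two points of one fibre.
  obtain ⟨S₀, hS₀A, hS₀c, hS₀⟩ := exists_countable_separating_jumps isClosed_closure hψ.continuous
    (A := (A : Set C(X, ℂ))) (fun x y hxy => by
      obtain ⟨_, ⟨g, hg, rfl⟩, hne⟩ := hAc.separatesPoints hxy
      exact ⟨g, hg, hne⟩) (hDc.union (countable_setOf_covBy hDc))
  obtain ⟨S, hS⟩ : ∃ S, S = insert f S₀ := ⟨_, rfl⟩
  have hSA : S ⊆ A := hS ▸ insert_subset hfA hS₀A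
  have hSc : S.Countable := hS ▸ hS₀c.insert f
  have hfS : f ∈ S := hS ▸ mem_insert _ _
  have : Countable S := hSc.to_subtype
  obtain ⟨B, hB⟩ : ∃ B, B = (Algebra.adjoin ℂ S).topologicalClosure := ⟨_, rfl⟩
  have hBc : IsClosed (B : Set C(X, ℂ)) := hB ▸ Subalgebra.isClosed_topologicalClosure _
  have hBA : B ≤ A := hB ▸ Subalgebra.topologicalClosure_minimal (Algebra.adjoin_le hSA) hAc.isClosed
  have hfB : f ∈ B := hB ▸ Subalgebra.le_topologicalClosure _ (Algebra.subset_adjoin hfS)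
  have hidB : OnlyTrivialIdempotents B := fun g hg => hid g (hBA hg)
  obtain ⟨Ω, hΩo, hΩc, hΩB, hΩf, hΩr⟩ := exists_outer_resolvent hBc hfB
  have hunc := hidB.not_countable_frontier hBc hΩB hΩf (x₀ := x₁) le_rfl ((hf1 x₁ hx₁).trans_le hf2)
  -- the Borel set of all fibres which are weak peak sets over the boundary of `Ω`
  obtain ⟨E, hE⟩ : ∃ E : Set (S → ℂ), E = range (evalOn S) ∩
      {m | IsWeakPeakSet B 40 (evalOn S ⁻¹' {m})} ∩
      (fun m => m ⟨f, hfS⟩) ⁻¹' (frontier Ω ∩ {z | ‖f x₁‖ < ‖z‖}) := ⟨_, rfl⟩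
  have hEm : MeasurableSet E := by
    rw [hE]
    refine ((isCompact_range (continuous_evalOn S)).isClosed.measurableSet.inter
      (measurableSet_isWeakPeakSet_fiber (continuous_evalOn S) _ _)).inter ?_
    exact (isClosed_frontier.measurableSet.inter
      (isOpen_lt continuous_const continuous_norm).measurableSet).preimage
      (continuous_apply _).measurable
  have hEc : ¬ E.Countable := fun h => by
    -- The `f`-coordinate maps `E` onto the uncountable part of the frontier beyond radius `‖f x₁‖`:
    -- minimal weak peak sets over its points are fibres.
    refine hunc ((h.image fun m => m ⟨f, hfS⟩).mono ?_)
    rintro z ⟨hz, hzρ⟩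
    obtain ⟨x, hx⟩ := hΩr hz
    obtain ⟨Q, hQz, ⟨y, hy⟩, hQ, hQc⟩ :=
      (isWeakPeakSet_preimage_singleton hBc hfB hΩo hΩc hΩB hΩf hz).exists_subset_const
        (by norm_num) (isClosed_singleton.preimage f.continuous) ⟨x, hx⟩
    have hyz : evalOn S y ⟨f, hfS⟩ = z := hQz hy
    subst hB
    refine ⟨evalOn S y, ?_, hyz⟩
    rw [hE]
    refine ⟨⟨mem_range_self y, ?_⟩, ?_⟩
    · change IsWeakPeakSet _ 40 _
      rwa [← hQ.eq_fiber hQc hy]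
    · rw [mem_preimage, hyz]
      exact ⟨hz, hzρ⟩
  have hEU : ∀ x, evalOn S x ∈ E → x ∈ U := fun x hx => by
    by_contra hxU
    rw [hE] at hx
    exact absurd (hρ x hxU) (not_le.2 hx.2.2)
  -- uncountably many fibres are nontrivial
  obtain ⟨P, hP⟩ : ∃ P : Set (S → ℂ), P = {m ∈ E | ¬ (evalOn S ⁻¹' {m}).Subsingleton} := ⟨_, rfl⟩
  have hPc : ¬ P.Countable := fun hPc => by
    refine hL (containsCantorSubset_of_subsingleton_fibers (continuous_evalOn S)
      (hEm.diff hPc.measurableSet) (fun h => hEc ?_) (fun m hm => ?_) (fun m hm => ?_)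
      (W := closure U) (fun x hx => subset_closure (hEU x hx.1)) hψ.continuous hψ.injective)
    · exact (h.union hPc).mono fun m hm => by
        by_cases hmP : m ∈ P
        · exact Or.inr hmP
        · exact Or.inl ⟨hm, hmP⟩
    · have := hm.1
      rw [hE] at this
      exact this.1.1
    · by_contra hns
      exact hm.2 (hP ▸ ⟨hm.1, hns⟩)
  have hgap : ∀ x y : closure U, evalOn S x = evalOn S y → ψ x < ψ y →
      ∀ d ∈ D, d ∉ Icc (ψ x) (ψ y) := fun x y hxy hlt =>
    hDd.disjoint_Icc_of_neighbours hlt fun d hd d' hd' hdd' hxd hdy => by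
      obtain ⟨g, hg, hne⟩ := hS₀ x y d hd d' hd' hdd' hxd hdy
      exact hne (congrFun hxy ⟨g, hS ▸ mem_insert_of_mem _ hg⟩)
  -- A third point between two points of a fibre would make the open interval nonempty, so it would
  -- meet `D`. Hence a nontrivial fibre over `E` has exactly two points.
  have hmid : ∀ x y z : closure U, evalOn S x = evalOn S z → ψ x < ψ y → ψ y < ψ z → False :=
    fun x y z hxz hxy hyz => by
      obtain ⟨d, hd, hdo⟩ := hDd.exists_mem_open isOpen_Ioo ⟨ψ y, hxy, hyz⟩
      exact hgap x z hxz (hxy.trans hyz) d hd (Ioo_subset_Icc_self hdo)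
  have hpair : ∀ m : P, ∃ a b : closure U, evalOn S a = m ∧ evalOn S b = m ∧ ψ a < ψ b := by
    rintro ⟨m, hm⟩
    rw [hP] at hm
    obtain ⟨x, hx, y, hy, hne⟩ := not_subsingleton_iff.1 hm.2
    have hxm : evalOn S x = m := hx
    have hym : evalOn S y = m := hy
    have hxU : x ∈ closure U := subset_closure (hEU x (hxm ▸ hm.1))
    have hyU : y ∈ closure U := subset_closure (hEU y (hym ▸ hm.1))
    rcases lt_trichotomy (ψ ⟨x, hxU⟩) (ψ ⟨y, hyU⟩) with h | h | h
    · exact ⟨⟨x, hxU⟩, ⟨y, hyU⟩, hx, hy, h⟩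
    · exact absurd (congrArg Subtype.val (hψ.injective h)) hne
    · exact ⟨⟨y, hyU⟩, ⟨x, hxU⟩, hy, hx, h⟩
  choose a b ha hb hab using hpair
  have : Uncountable P := by
    rw [← not_countable_iff]
    exact fun h => hPc (to_countable P)
  refine false_of_uncountable_cuts hAc.isClosed hid hBA
    (hB ▸ isSeparable_topologicalClosure_adjoin hSc) hUne hψ.injective hDc
    (I := P) (a := a) (b := b) (fun m n hmn => Subtype.ext ?_) fun m => ?_
  · rw [← ha m, ← ha n, hmn]
  · have hmE : m.1 ∈ E := (hP.subset m.2).1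
    have hmE' := hmE
    rw [hE] at hmE'
    refine exists_isCut hAc.separatesPoints hUo subset_closure hψ hDd hmE'.1.2 ?_ (hEU _ (ha m ▸ hmE))
      (hEU _ (hb m ▸ hmE)) (hab m) (hgap _ _ ((ha m).trans (hb m).symm) (hab m))
    refine subset_antisymm (fun x hx => ?_) ?_
    · have hxm : evalOn S x = m.1 := hx
      have hxU : x ∈ closure U := subset_closure (hEU x (hxm ▸ hmE))
      rcases lt_trichotomy (ψ ⟨x, hxU⟩) (ψ (a m)) with h | h | h
      · exact (hmid ⟨x, hxU⟩ (a m) (b m) (hxm.trans (hb m).symm) h (hab m)).elim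
      · exact Or.inl (congrArg Subtype.val (hψ.injective h))
      · rcases lt_trichotomy (ψ ⟨x, hxU⟩) (ψ (b m)) with h' | h' | h'
        · exact (hmid (a m) ⟨x, hxU⟩ (b m) ((ha m).trans (hb m).symm) h h').elim
        · exact Or.inr (congrArg Subtype.val (hψ.injective h'))
        · exact (hmid (a m) (b m) ⟨x, hxU⟩ ((ha m).trans hxm.symm) (hab m) h').elim
    · rintro x (rfl | rfl)
      · exact ha m
      · exact hb m
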